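/- Let $\mathbf v=(k_1,\dots,k_u)$ be a sequence of non-zero integers. The pretzel link diagram $P(k_1,\dots,k_u)$ is obtained from $u$ pairs of parallel vertical strands, the $i$-th pair carrying $|k_i|$ half-twists (right-handed if $k_i>0$, left-handed if $k_i<0$), by joining the $i$-th pair to the $(i+1)$-st pair (indices modulo $u$) by one arc at the top and one arc at the bottom. A sequence of non-zero integers of even length $2v\ge 2$ is called erasable if either $v=1$ and $k_1+k_2=0$, or $v\ge 2$ and there are $i<j$ with $k_i+k_j=0$ such that the sequence of length $2v-2$ obtained by deleting $k_i$ and $k_j$ is erasable (equivalently, its entries can be paired off into pairs with sum zero). For an oriented link $\mathcal K$, let $\nabla_{\mathcal K}(z)\in\mathbb Z[z]$ be its Conway polynomial, i.e. the link invariant determined by $\nabla(z)=1$ for the unknot and $\nabla_{L_+}(z)-\nabla_{L_-}(z)=z\,\nabla_{L_0}(z)$ for links $L_+,L_-,L_0$ with oriented diagrams that differ only near one crossing, which is positive, negative and smoothed along the orientation, respectively. Proposition. Let $\mathcal K$ be a $2$-component link, with any orientation of its components, that has a diagram $P(k_1,\dots,k_{2v})$ such that $(k_1,\dots,k_{2v})$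 is erasable. Then $\nabla_{\mathcal K}(z)=0$. -/

import Mathlib

/-- A link diagram, unoriented, in the style of a planar diagram code.  Every crossing has four
ends, numbered `0, 1, 2, 3` in counterclockwise order (think of NE, NW, SW, SE), so the two
strands through it join the ends `0, 2` and the ends `1, 3`.  The involution `mate` records which
ends are joined by the arcs of the diagram, and `evenOver c` says whether the strand `0, 2` is the
over-strand at `c`.  (Every component passes through at least one crossing.) -/
structure LinkDiagram where
  Crossing : Type
  fintypeCrossing : Fintype Crossing
  decEqCrossing : DecidableEq Crossing
  mate : Crossing × Fin 4 → Crossing × Fin 4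
  mate_mate : ∀ h, mate (mate h) = h
  mate_ne : ∀ h, mate h ≠ h
  evenOver : Crossing → Bool

namespace LinkDiagram

attribute [instance] LinkDiagram.fintypeCrossing LinkDiagram.decEqCrossing

/-- The ends at the crossings of a diagram. -/
abbrev End (D : LinkDiagram) : Type := D.Crossing × Fin 4

/-- The other end of the strand through the same crossing. -/
def opp (D : LinkDiagram) (h : D.End) : D.End := (h.1, h.2 + 2)

/-- The end `h` belongs to the over-strand of its crossing. -/
def IsOver (D : LinkDiagram) (h : D.End) : Prop :=
  h.2.val % 2 = 0 ↔ D.evenOver h.1 = true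

/-- The components of the link: ends are identified when they are joined by an arc of the diagram
or by a strand through a crossing. -/
def Component (D : LinkDiagram) : Type :=
  Quot (fun h h' : D.End => h' = D.mate h ∨ h' = D.opp h)

/-- The number of components of the link. -/
noncomputable def numComponents (D : LinkDiagram) : ℕ := Nat.card D.Component

/-- An orientation of the link: `out h` says that the link leaves the crossing at the end `h`.
Opposite ends, and the two ends of an arc, carry opposite values. -/
structure Orientation (D : LinkDiagram) where
  out : D.End → Bool
  out_mate : ∀ h, out (D.mate h) = !(out h)
  out_opp : ∀ h, out (D.opp h) = !(out h)

open Classical in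
/-- The sign of a crossing: it is `+1` if the outgoing end of the under-strand is the
counterclockwise neighbour of the outgoing end of the over-strand, and `-1` otherwise. -/
noncomputable def sign (D : LinkDiagram) (o : D.Orientation) (c : D.Crossing) : ℤ :=
  if ∃ i : Fin 4, D.IsOver (c, i) ∧ o.out (c, i) = true ∧ o.out (c, i + 1) = true then 1 else -1

/-- The end at which one leaves the crossing of the incoming end `h`, in the diagram in which the
crossings in `T` are smoothed according to the orientation: at a crossing that is not smoothed this
is the opposite end, and at a smoothed one it is the outgoing end next to `h`. -/
def exit (D : LinkDiagram) (o : D.Orientation) (T : Finset D.Crossing) (h : D.End) : D.End :=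
  if h.1 ∈ T then
    if o.out (h.1, h.2 + 1) = true then (h.1, h.2 + 1) else (h.1, h.2 + 3)
  else D.opp h

/-- Walking along the diagram smoothed at `T`: from an incoming end to the next incoming end. -/
def walk (D : LinkDiagram) (o : D.Orientation) (T : Finset D.Crossing) (h : D.End) : D.End :=
  D.mate (D.exit o T h)

/-- The diagram smoothed at `T` is a single closed curve: the walk from the incoming end `b` meets
all incoming ends. -/
def IsSingleCurve (D : LinkDiagram) (o : D.Orientation) (T : Finset D.Crossing) (b : D.End) :
    Prop :=
  ∀ h : D.End, o.out h = false → ∃ n : ℕ, (D.walk o T)^[n] b = h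

/-- The walk from `b` along the diagram smoothed at `T` comes to `c` for the first time on the
under-strand of `c`. -/
def FirstUnder (D : LinkDiagram) (o : D.Orientation) (T : Finset D.Crossing) (b : D.End)
    (c : D.Crossing) : Prop :=
  ∃ n : ℕ, ((D.walk o T)^[n] b).1 = c ∧ ¬ D.IsOver ((D.walk o T)^[n] b) ∧
    ∀ m < n, ((D.walk o T)^[m] b).1 ≠ c

open Classical in
/-- The Conway polynomial of the oriented link diagram obtained from `D` by smoothing the crossings
in `T`, computed from a base point just before the incoming end `b`.

This is the resolution of the diagram by the skein relation `∇(L₊) - ∇(L₋) = z ∇(L₀)`.  Walk along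
the diagram from the base point; whenever a crossing is met for the first time on its under-strand,
replace the diagram by the one with that crossing switched, plus `sign * z` times the one with that
crossing smoothed, and walk on in each of the two.  When the walk closes up, the component of the
base point is an unknot that lies above all the rest, so the final diagram contributes `1` if it has
no other component, and `0` otherwise (a split link).  The sum below collects the final diagrams
according to the set `S` of crossings that were smoothed. -/
noncomputable def conwaySmoothed (D : LinkDiagram) (o : D.Orientation) (T : Finset D.Crossing)
    (b : D.End) : Polynomial ℤ :=
  ∑ S ∈ Tᶜ.powerset,
    if D.IsSingleCurve o (T ∪ S) b ∧ ∀ c ∈ S, D.FirstUnder o (T ∪ S) b c then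
      Polynomial.C (∏ c ∈ S, D.sign o c) * Polynomial.X ^ S.card
    else 0

/-- The Conway polynomial `∇(z)` of an oriented link diagram, computed from a base point just
before the incoming end `b`. -/
noncomputable def conway (D : LinkDiagram) (o : D.Orientation) (b : D.End) : Polynomial ℤ :=
  D.conwaySmoothed o ∅ b

/-- The diagram with the crossing `c` switched. -/
def switch (D : LinkDiagram) (c : D.Crossing) : LinkDiagram :=
  { D with evenOver := fun x => if x = c then !(D.evenOver x) else D.evenOver x }

/-- The same orientation on the diagram with the crossing `c` switched. -/
def Orientation.switch {D : LinkDiagram} (o : D.Orientation) (c : D.Crossing) :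
    (D.switch c).Orientation where
  out := o.out
  out_mate := o.out_mate
  out_opp := o.out_opp

theorem isOver_switch_self (D : LinkDiagram) {c : D.Crossing} (h : D.End) (hc : h.1 = c) :
    (D.switch c).IsOver h ↔ ¬ D.IsOver h := by
  simp only [IsOver, switch, hc, if_true]
  cases D.evenOver c <;> simp

theorem isOver_switch_of_ne (D : LinkDiagram) {c : D.Crossing} (h : D.End) (hc : h.1 ≠ c) :
    (D.switch c).IsOver h ↔ D.IsOver h := by
  simp only [IsOver, switch, hc, if_false]

theorem sign_switch_of_ne (D : LinkDiagram) (o : D.Orientation) {c x : D.Crossing} (h : x ≠ c) :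
    (D.switch c).sign (o.switch c) x = D.sign o x := by
  have key : ∀ i : Fin 4, (D.switch c).IsOver (x, i) ↔ D.IsOver (x, i) := fun i =>
    D.isOver_switch_of_ne (x, i) h
  have key' : (∃ i : Fin 4, (D.switch c).IsOver (x, i) ∧ (o.switch c).out (x, i) = true ∧
      (o.switch c).out (x, i + 1) = true) ↔
      ∃ i : Fin 4, D.IsOver (x, i) ∧ o.out (x, i) = true ∧ o.out (x, i + 1) = true :=
    exists_congr fun i => and_congr_left fun _ => key i
  unfold sign
  by_cases hx : ∃ i : Fin 4, D.IsOver (x, i) ∧ o.out (x, i) = true ∧ o.out (x, i + 1) = true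
  · rw [if_pos hx]
    exact if_pos (key'.2 hx)
  · rw [if_neg hx]
    exact if_neg fun h' => hx (key'.1 h')

/-- Switching a crossing reverses its sign. -/
theorem sign_switch_self (D : LinkDiagram) (o : D.Orientation) (c : D.Crossing) :
    (D.switch c).sign (o.switch c) c = - D.sign o c := by
  have h0 : o.out (c, 2) = !(o.out (c, 0)) := o.out_opp (c, 0)
  have h1 : o.out (c, 3) = !(o.out (c, 1)) := o.out_opp (c, 1)
  have key : ∀ i : Fin 4, (D.switch c).IsOver (c, i) ↔ ¬ D.IsOver (c, i) := fun i =>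
    D.isOver_switch_self (c, i) rfl
  have e : ∀ i : Fin 4, (o.switch c).out (c, i) = o.out (c, i) := fun _ => rfl
  have v0 : D.IsOver (c, 0) ↔ D.evenOver c = true := by simp [IsOver]
  have v1 : D.IsOver (c, 1) ↔ ¬ D.evenOver c = true := by simp [IsOver]
  have v2 : D.IsOver (c, 2) ↔ D.evenOver c = true := by simp [IsOver]
  have v3 : D.IsOver (c, 3) ↔ ¬ D.evenOver c = true := by
    simp [IsOver]
  have ex : ∀ p : Fin 4 → Prop, (∃ i, p i) ↔ p 0 ∨ p 1 ∨ p 2 ∨ p 3 := by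
    intro p
    constructor
    · rintro ⟨i, hi⟩
      fin_cases i <;> tauto
    · rintro (h | h | h | h) <;> exact ⟨_, h⟩
  have a1 : (0 : Fin 4) + 1 = 1 := rfl
  have a2 : (1 : Fin 4) + 1 = 2 := rfl
  have a3 : (2 : Fin 4) + 1 = 3 := rfl
  have a4 : (3 : Fin 4) + 1 = 0 := rfl
  unfold sign
  simp only [ex, key, e, v0, v1, v2, v3, a1, a2, a3, a4, h0, h1]
  cases D.evenOver c <;> cases o.out (c, 0) <;> cases o.out (c, 1) <;> simp

theorem firstUnder_switch_of_ne (D : LinkDiagram) (o : D.Orientation) (T : Finset D.Crossing)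
    (b : D.End) {c x : D.Crossing} (h : x ≠ c) :
    (D.switch c).FirstUnder (o.switch c) T b x ↔ D.FirstUnder o T b x := by
  refine exists_congr fun n => and_congr_right fun hn => and_congr_left fun _ => ?_
  exact not_congr (D.isOver_switch_of_ne _ (fun h' => h (hn.symm.trans h')))

/-- On a single closed curve every crossing is met, for the first time either on its under-strand
or on its over-strand. -/
theorem firstUnder_switch_self (D : LinkDiagram) (o : D.Orientation) (T : Finset D.Crossing)
    (b : D.End) (c : D.Crossing) (hT : D.IsSingleCurve o T b) :
    (D.switch c).FirstUnder (o.switch c) T b c ↔ ¬ D.FirstUnder o T b c := by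
  classical
  have hex : ∃ n : ℕ, ((D.walk o T)^[n] b).1 = c := by
    have h0 : o.out (c, 2) = !(o.out (c, 0)) := o.out_opp (c, 0)
    cases h : o.out (c, 0) with
    | false => obtain ⟨n, hn⟩ := hT (c, 0) h; exact ⟨n, by rw [hn]⟩
    | true => obtain ⟨n, hn⟩ := hT (c, 2) (by rw [h0, h]; rfl); exact ⟨n, by rw [hn]⟩
  have uniq : ∀ n : ℕ, ((D.walk o T)^[n] b).1 = c → (∀ m < n, ((D.walk o T)^[m] b).1 ≠ c) →
      n = Nat.find hex := by
    intro n hn hm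
    refine le_antisymm ?_ (Nat.find_min' hex hn)
    by_contra hlt
    exact hm _ (not_le.1 hlt) (Nat.find_spec hex)
  have h1 : D.FirstUnder o T b c ↔ ¬ D.IsOver ((D.walk o T)^[Nat.find hex] b) := by
    constructor
    · rintro ⟨n, hn, hu, hm⟩
      rwa [← uniq n hn hm]
    · intro h
      exact ⟨_, Nat.find_spec hex, h, fun m hm => Nat.find_min hex hm⟩
  have h2 : (D.switch c).FirstUnder (o.switch c) T b c ↔
      ¬ (D.switch c).IsOver ((D.walk o T)^[Nat.find hex] b) := by
    constructor
    · rintro ⟨n, hn, hu, hm⟩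
      have := uniq n hn hm
      rw [← this]
      exact hu
    · intro h
      exact ⟨_, Nat.find_spec hex, h, fun m hm => Nat.find_min hex hm⟩
  rw [h1, h2, D.isOver_switch_self _ (Nat.find_spec hex)]

open Classical in
theorem skein_sum_aux {α : Type} [Fintype α] [DecidableEq α] (one : Finset α → Prop)
    (F F' : Finset α → α → Prop) (s s' : α → ℤ) (T : Finset α) (c : α) (hc : c ∉ T)
    (hF : ∀ U x, x ≠ c → (F' U x ↔ F U x)) (hFc : ∀ U, one U → (F' U c ↔ ¬ F U c))
    (hs : ∀ x, x ≠ c → s' x = s x) (hsc : s' c = - s c) :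
    (∑ S ∈ Tᶜ.powerset, if one (T ∪ S) ∧ ∀ x ∈ S, F (T ∪ S) x then
        Polynomial.C (∏ x ∈ S, s x) * Polynomial.X ^ S.card else 0) -
      (∑ S ∈ Tᶜ.powerset, if one (T ∪ S) ∧ ∀ x ∈ S, F' (T ∪ S) x then
        Polynomial.C (∏ x ∈ S, s' x) * Polynomial.X ^ S.card else 0) =
      Polynomial.C (s c) * Polynomial.X *
        ∑ S ∈ (insert c T)ᶜ.powerset, if one (insert c T ∪ S) ∧ ∀ x ∈ S, F (insert c T ∪ S) x then
          Polynomial.C (∏ x ∈ S, s x) * Polynomial.X ^ S.card else 0 := by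
  have hT : Tᶜ = insert c (insert c T)ᶜ := by
    ext x
    by_cases hx : x = c <;> simp [hx, hc]
  have hcn : c ∉ (insert c T)ᶜ := by simp
  have e1 : ∀ f : Finset α → Polynomial ℤ, ∑ S ∈ Tᶜ.powerset, f S =
      ∑ S ∈ ((insert c T)ᶜ).powerset, f S + ∑ S ∈ ((insert c T)ᶜ).powerset, f (insert c S) := by
    intro f
    rw [hT, Finset.sum_powerset_insert hcn]
  rw [e1, e1, add_sub_add_comm, ← Finset.sum_sub_distrib,
    ← Finset.sum_sub_distrib, Finset.mul_sum, ← Finset.sum_add_distrib]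
  refine Finset.sum_congr rfl fun S hS => ?_
  have hcS : c ∉ S := fun h => hcn (Finset.mem_powerset.1 hS h)
  have hne : ∀ x ∈ S, x ≠ c := fun x hx h => hcS (h ▸ hx)
  have p : ∏ x ∈ S, s' x = ∏ x ∈ S, s x := Finset.prod_congr rfl fun x hx => hs x (hne x hx)
  have q : ∀ U, (∀ x ∈ S, F' U x) ↔ ∀ x ∈ S, F U x := fun U =>
    forall₂_congr fun x hx => hF U x (hne x hx)
  have u : T ∪ insert c S = insert c T ∪ S := by
    ext x; simp only [Finset.mem_union, Finset.mem_insert]; tauto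
  simp only [Finset.forall_mem_insert, q, p, u, Finset.prod_insert hcS,
    Finset.card_insert_of_notMem hcS, hsc]
  generalize insert c T ∪ S = U
  rw [sub_self, zero_add]
  by_cases h : one U ∧ ∀ x ∈ S, F U x
  · have r := hFc _ h.1
    rw [if_pos h]
    by_cases h2 : F U c
    · rw [if_pos ⟨h.1, h2, h.2⟩, if_neg fun h' => r.1 h'.2.1 h2, Polynomial.C_mul, pow_succ]
      ring
    · rw [if_neg fun h' => h2 h'.2.1, if_pos ⟨h.1, r.2 h2, h.2⟩, Polynomial.C_mul,
        Polynomial.C_neg, pow_succ]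
      ring
  · rw [if_neg h, if_neg fun h' => h ⟨h'.1, h'.2.2⟩, if_neg fun h' => h ⟨h'.1, h'.2.2⟩]
    simp

/-- The skein relation: `∇(D) - ∇(D switched at c) = sign(c) z ∇(D smoothed at c)`. -/
theorem conwaySmoothed_skein (D : LinkDiagram) (o : D.Orientation) (T : Finset D.Crossing)
    (b : D.End) (c : D.Crossing) (hc : c ∉ T) :
    D.conwaySmoothed o T b - (D.switch c).conwaySmoothed (o.switch c) T b =
      Polynomial.C (D.sign o c) * Polynomial.X * D.conwaySmoothed o (insert c T) b := by
  exact skein_sum_aux (fun U => D.IsSingleCurve o U b) (fun U x => D.FirstUnder o U b x)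
    (fun U x => (D.switch c).FirstUnder (o.switch c) U b x) (D.sign o)
    ((D.switch c).sign (o.switch c)) T c hc
    (fun U x hx => D.firstUnder_switch_of_ne o U b hx)
    (fun U hU => D.firstUnder_switch_self o U b c hU)
    (fun x hx => D.sign_switch_of_ne o hx) (D.sign_switch_self o c)

open Classical in
/-- The normalization: if no crossing is met for the first time on its under-strand, so that the
component of the base point is an unknot that lies above all the rest, then the polynomial is `1`
for a single component and `0` otherwise. -/
theorem conwaySmoothed_of_descending (D : LinkDiagram) (o : D.Orientation)
    (T : Finset D.Crossing) (b : D.End) (hdesc : ∀ c, c ∉ T → ¬ D.FirstUnder o T b c) :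
    D.conwaySmoothed o T b = if D.IsSingleCurve o T b then 1 else 0 := by
  rw [conwaySmoothed, Finset.sum_eq_single_of_mem ∅ (by simp)]
  · simp
  · intro S hS hne
    rw [if_neg]
    rintro ⟨-, hS'⟩
    obtain ⟨c, hc⟩ := Finset.nonempty_iff_ne_empty.2 hne
    have hex : ∃ n : ℕ, ((D.walk o (T ∪ S))^[n] b).1 ∈ S := by
      obtain ⟨n, hn, -⟩ := hS' c hc
      exact ⟨n, by rw [hn]; exact hc⟩
    have agree : ∀ n ≤ Nat.find hex, (D.walk o (T ∪ S))^[n] b = (D.walk o T)^[n] b := by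
      intro n
      induction n with
      | zero => intro _; rfl
      | succ n ih =>
        intro hn
        have hnS := Nat.find_min hex (m := n) (by omega)
        have ihn := ih (by omega)
        rw [Function.iterate_succ_apply', Function.iterate_succ_apply', ← ihn]
        simp [walk, exit, hnS]
    obtain ⟨n, hn, hu, hm⟩ := hS' _ (Nat.find_spec hex)
    have hle : n ≤ Nat.find hex := by
      by_contra hlt
      exact hm _ (not_le.1 hlt) rfl
    refine hdesc ((D.walk o (T ∪ S))^[Nat.find hex] b).1 (fun hT => ?_)
      ⟨n, ?_, ?_, fun m hmn => ?_⟩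
    · exact (Finset.mem_compl.1 (Finset.mem_powerset.1 hS (Nat.find_spec hex))) hT
    · rw [← agree n hle]; exact hn
    · rw [← agree n hle]; exact hu
    · rw [← agree m (by omega)]; exact hm m hmn

end LinkDiagram

/-! ### Pretzel diagrams -/

/-- The crossings of the pretzel diagram `P(k_1, …, k_u)`: the `i`-th pair of strands carries
`|k_i|` half-twists, numbered from the top to the bottom. -/
abbrev PretzelCrossing {u : ℕ} (k : Fin u → ℤ) : Type := Σ i : Fin u, Fin (k i).natAbs

/-- The arcs of the pretzel diagram.  The ends of a crossing are `0` = NE, `1` = NW, `2` = SW,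
`3` = SE.  Consecutive crossings of one pair of strands are joined by two arcs; the top right of the
`i`-th pair is joined to the top left of the next one (cyclically) by a top bridge, and the bottom
right to the bottom left by a bottom bridge. -/
def pretzelMate {u : ℕ} (k : Fin u → ℤ) (hk : ∀ i, k i ≠ 0) :
    PretzelCrossing k × Fin 4 → PretzelCrossing k × Fin 4
  | (⟨i, j⟩, 0) =>
      if j.val = 0 then
        (⟨finRotate u i, ⟨0, Int.natAbs_pos.2 (hk _)⟩⟩, 1)
      else (⟨i, ⟨j.val - 1, by omega⟩⟩, 3)
  | (⟨i, j⟩, 1) =>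
      if j.val = 0 then
        (⟨(finRotate u).symm i, ⟨0, Int.natAbs_pos.2 (hk _)⟩⟩, 0)
      else (⟨i, ⟨j.val - 1, by omega⟩⟩, 2)
  | (⟨i, j⟩, 2) =>
      if h : j.val + 1 < (k i).natAbs then (⟨i, ⟨j.val + 1, h⟩⟩, 1)
      else
        (⟨(finRotate u).symm i, ⟨(k ((finRotate u).symm i)).natAbs - 1,
          Nat.sub_lt (Int.natAbs_pos.2 (hk _)) one_pos⟩⟩, 3)
  | (⟨i, j⟩, 3) =>
      if h : j.val + 1 < (k i).natAbs then (⟨i, ⟨j.val + 1, h⟩⟩, 0)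
      else
        (⟨finRotate u i, ⟨(k (finRotate u i)).natAbs - 1,
          Nat.sub_lt (Int.natAbs_pos.2 (hk _)) one_pos⟩⟩, 2)

theorem pretzelCrossing_ext {u : ℕ} {k : Fin u → ℤ} {i i' : Fin u} (e : i = i')
    (a : Fin (k i).natAbs) (a' : Fin (k i').natAbs) (h : a.val = a'.val) :
    (⟨i, a⟩ : PretzelCrossing k) = ⟨i', a'⟩ := by
  subst e
  congr 1
  exact Fin.ext h

theorem pretzelMate_mate {u : ℕ} (k : Fin u → ℤ) (hk : ∀ i, k i ≠ 0)
    (h : PretzelCrossing k × Fin 4) : pretzelMate k hk (pretzelMate k hk h) = h := by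
  obtain ⟨⟨i, j⟩, e⟩ := h
  have hj := j.isLt
  have e1 : (finRotate u).symm (finRotate u i) = i := Equiv.symm_apply_apply _ _
  have e2 : finRotate u ((finRotate u).symm i) = i := Equiv.apply_symm_apply _ _
  have hki := Int.natAbs_pos.2 (hk (finRotate u i))
  have hki' := Int.natAbs_pos.2 (hk ((finRotate u).symm i))
  fin_cases e
  · by_cases h0 : j.val = 0
    · simp only [pretzelMate, h0, if_true]
      exact Prod.ext (pretzelCrossing_ext e1 _ _ h0.symm) rfl
    · simp only [pretzelMate, h0, if_false]
      rw [dif_pos (by omega)]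
      exact Prod.ext (pretzelCrossing_ext rfl _ _ (by simp; omega)) rfl
  · by_cases h0 : j.val = 0
    · simp only [pretzelMate, h0, if_true]
      exact Prod.ext (pretzelCrossing_ext e2 _ _ h0.symm) rfl
    · simp only [pretzelMate, h0, if_false]
      rw [dif_pos (by omega)]
      exact Prod.ext (pretzelCrossing_ext rfl _ _ (by simp; omega)) rfl
  · by_cases h0 : j.val + 1 < (k i).natAbs
    · simp [pretzelMate, h0]
    · simp only [pretzelMate, h0, dif_neg, not_false_eq_true]
      rw [dif_neg (by omega)]
      exact Prod.ext (pretzelCrossing_ext e2 _ _ (by simp only [e2]; omega)) rfl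
  · by_cases h0 : j.val + 1 < (k i).natAbs
    · simp [pretzelMate, h0]
    · simp only [pretzelMate, h0, dif_neg, not_false_eq_true]
      rw [dif_neg (by omega)]
      exact Prod.ext (pretzelCrossing_ext e1 _ _ (by simp only [e1]; omega)) rfl

theorem pretzelMate_ne {u : ℕ} (k : Fin u → ℤ) (hk : ∀ i, k i ≠ 0)
    (h : PretzelCrossing k × Fin 4) : pretzelMate k hk h ≠ h := by
  obtain ⟨⟨i, j⟩, e⟩ := h
  intro he
  have h2 := congrArg Prod.snd he
  fin_cases e <;> simp only [pretzelMate] at h2 <;> split_ifs at h2 <;> simp at h2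

/-- The pretzel link diagram `P(k_1, …, k_u)` of a sequence of non-zero integers.  For `k_i > 0` the
half-twists are right-handed (the over-strand runs from the bottom left to the top right), and for
`k_i < 0` they are left-handed. -/
def pretzel {u : ℕ} (k : Fin u → ℤ) (hk : ∀ i, k i ≠ 0) : LinkDiagram where
  Crossing := PretzelCrossing k
  fintypeCrossing := inferInstance
  decEqCrossing := inferInstance
  mate := pretzelMate k hk
  mate_mate := pretzelMate_mate k hk
  mate_ne := pretzelMate_ne k hk
  evenOver := fun c => decide (0 < k c.1)

/-- Erasable sequences: `(a, b)` with `a + b = 0`, and the sequences in which there are two entries,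
at different places, with sum zero whose deletion leaves an erasable sequence. -/
inductive Erasable : List ℤ → Prop
  | pair (a b : ℤ) (h : a + b = 0) : Erasable [a, b]
  | step (l : List ℤ) (i j : ℕ) (hij : i < j) (hj : j < l.length)
      (h : l[i] + l[j] = 0) (hl : Erasable ((l.eraseIdx j).eraseIdx i)) : Erasable l

/-!
The Conway polynomial is defined as a state sum obtained by resolving the diagram to
descending ones.  It is compared with a determinant of Fox calculus, and this determinant is shown
to vanish by exhibiting a colouring of the diagram that is not constant.

*The determinant.*  For a real `q ≠ 0` put `t = q ^ 2` and `z = q⁻¹ - q`.  The Fox relations of a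
smoothed diagram at the parameter `t`, with the value at the base point set to zero, form a square
matrix indexed by the ends; its determinant, normalized by `q` to the power minus the writhe, is
`foxDet`.  It obeys the skein relation of the Conway polynomial (`foxDet_skein`).  On a descending
diagram that is a single curve the matrix is triangular with ones on the diagonal
(`IsTraversal.foxDet_descending`), so `foxDet` is the power of `q` with exponent minus the writhe.
On a descending diagram with further components the powers of `t` given by the winding number around
the component of the base point are in the kernel, so `foxDet` is zero
(`foxDet_descending_of_not_single`).  Hence `foxDet` is `q ^ (-κ)` times the value of the Conway
polynomial at `z` (`foxDet_eq_eval`), provided that all descending single curves that arise have the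
same writhe `κ`.

*Planarity.*  Winding numbers exist, and `κ` is constant, because the diagram lies in the plane.
A `LinkDiagram` is combinatorial, so both facts are proved for pretzel diagrams directly.  The
first one says that a conserved flow along the arcs has a potential (`exists_pretzel_potential`).
For the second one, the order in which the ends are met, signed by their directions, is an
antisymmetric form on the ends; the difference of two of these is conserved in each variable, and
its local self-intersection number vanishes (`pretzel_sum_form_eq_zero`, `totalOrder_pretzel`).

*Colourings.*  A colouring that is not constant puts a non-zero vector into the kernel of the
matrix.  If there is one for infinitely many `q > 1`, the Conway polynomial has infinitely many
zeros and vanishes (`conway_pretzel_eq_zero_of_coloring`).  A colouring of a pretzel diagram amounts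
to increments `d i` of the colour across the top of the columns, with sum zero, such that the
changes of the colour from top to bottom agree for columns that are joined by bridges
(`exists_isFoxColoring_pretzel_of_increments`).  There are two cases.
* All columns with an odd number of half-twists have parallel strands.  Prescribing the changes from
  top to bottom by the directions of the bridges alone, one finds that `d i` is an odd function of
  `k i` plus a term with sum zero.  This odd function depends on whether the column is parallel or
  antiparallel; as the link has two components, there are at most two columns of even length, so
  that the antiparallel columns are none or exactly those of even length.  Odd functions sum up to
  zero over an erasable sequence (`exists_isFoxColoring_of_odd_parallel`).
* Otherwise all columns have odd length and antiparallel strands.  Then the changes from top to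
  bottom are multiplied by a factor `-α (-k i) / α (k i)` at each column, and the product of these
  factors is one for an erasable sequence (`exists_isFoxColoring_of_antiparallel`).
-/

namespace LinkDiagram

/-! ### Traversing a smoothed diagram end by end -/

variable {D : LinkDiagram}

/-- The direction of an end: `1` if the link leaves the crossing there, `-1` if it enters. -/
def Orientation.dir (o : D.Orientation) (h : D.End) : ℤ := if o.out h = true then 1 else -1

theorem Orientation.dir_mate (o : D.Orientation) (h : D.End) : o.dir (D.mate h) = -o.dir h := by
  simp only [Orientation.dir, o.out_mate]
  cases o.out h <;> simp

theorem Orientation.dir_eq_or (o : D.Orientation) (h : D.End) : o.dir h = 1 ∨ o.dir h = -1 := by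
  unfold Orientation.dir
  split_ifs <;> simp

theorem Orientation.dir_mul_self (o : D.Orientation) (h : D.End) : o.dir h * o.dir h = 1 := by
  simp only [Orientation.dir]
  split_ifs <;> simp

theorem Orientation.out_add_two (o : D.Orientation) (c : D.Crossing) (i : Fin 4) :
    o.out (c, i + 2) = !o.out (c, i) := o.out_opp (c, i)

theorem Orientation.out_add_three (o : D.Orientation) (c : D.Crossing) (i : Fin 4) :
    o.out (c, i + 3) = !o.out (c, i + 1) := by
  have h : i + 3 = i + 1 + 2 := by rw [add_assoc]; rfl
  rw [h]
  exact o.out_opp (c, i + 1)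

theorem Orientation.dir_add_two (o : D.Orientation) (c : D.Crossing) (i : Fin 4) :
    o.dir (c, i + 2) = -o.dir (c, i) := by
  simp only [Orientation.dir, o.out_add_two]
  cases o.out (c, i) <;> simp

/-- The other end of the strand through `h`, in the diagram in which the crossings in `T` are
smoothed: at a smoothed crossing it is the neighbour of `h` with the opposite direction. -/
def partner (D : LinkDiagram) (o : D.Orientation) (T : Finset D.Crossing) (h : D.End) : D.End :=
  if h.1 ∈ T then
    if o.out (h.1, h.2 + 1) = o.out h then (h.1, h.2 + 3) else (h.1, h.2 + 1)
  else D.opp h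

variable (o : D.Orientation) (T : Finset D.Crossing)

theorem partner_fst (h : D.End) : (D.partner o T h).1 = h.1 := by
  unfold partner
  split_ifs <;> rfl

theorem out_partner (h : D.End) : o.out (D.partner o T h) = !o.out h := by
  obtain ⟨c, i⟩ := h
  unfold partner
  split_ifs with h1 h2
  · simp only [o.out_add_three] at *
    rw [h2]
  · simp only at h2 ⊢
    cases h3 : o.out (c, i + 1) <;> cases h4 : o.out (c, i) <;> simp_all
  · exact o.out_opp _

theorem dir_partner (h : D.End) : o.dir (D.partner o T h) = -o.dir h := by
  simp only [Orientation.dir, out_partner]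
  cases o.out h <;> simp

theorem partner_partner (h : D.End) : D.partner o T (D.partner o T h) = h := by
  obtain ⟨c, i⟩ := h
  by_cases hc : c ∈ T
  · have e1 : i + 3 + 1 = i := by rw [add_assoc]; exact add_zero i
    have e2 : i + 1 + 3 = i := by rw [add_assoc]; exact add_zero i
    have e3 : i + 1 + 1 = i + 2 := by rw [add_assoc]; rfl
    by_cases h2 : o.out (c, i + 1) = o.out (c, i)
    · simp [partner, hc, h2, e1, o.out_add_three]
    · have h3 : ¬ o.out (c, i + 2) = o.out (c, i + 1) → False := by
        rw [o.out_add_two]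
        cases h3 : o.out (c, i + 1) <;> cases h4 : o.out (c, i) <;> simp_all
      simp only [partner, hc, h2, if_true, if_false, e2, e3]
      rw [if_pos (not_not.1 h3)]
  · simp [partner, hc, opp]
    rw [add_assoc]; exact add_zero i

theorem partner_ne (h : D.End) : D.partner o T h ≠ h := by
  intro h'
  have := out_partner o T h
  rw [h'] at this
  cases h2 : o.out h <;> simp_all

/-- The successor of an end along the oriented diagram smoothed at `T`: from an outgoing end along
the arc, and from an incoming end through the crossing. -/
def next (D : LinkDiagram) (o : D.Orientation) (T : Finset D.Crossing) (h : D.End) : D.End :=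
  if o.out h = true then D.mate h else D.partner o T h

theorem next_of_out {h : D.End} (hh : o.out h = true) : D.next o T h = D.mate h := if_pos hh

theorem next_of_in {h : D.End} (hh : o.out h = false) : D.next o T h = D.partner o T h :=
  if_neg (by simp [hh])

theorem out_next (h : D.End) : o.out (D.next o T h) = !o.out h := by
  unfold next
  split_ifs
  · exact o.out_mate h
  · exact out_partner o T h

theorem dir_next (h : D.End) : o.dir (D.next o T h) = -o.dir h := by
  simp only [Orientation.dir, out_next]
  cases o.out h <;> simp

theorem next_injective : Function.Injective (D.next o T) := by
  intro h h' e
  have e' : o.out h = o.out h' := by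
    have := congrArg o.out e
    rwa [out_next, out_next, Bool.not_inj_iff] at this
  unfold next at e
  rw [e'] at e
  split_ifs at e
  · rw [← D.mate_mate h, e, D.mate_mate]
  · rw [← partner_partner o T h, e, partner_partner]

theorem exit_eq_partner {h : D.End} (hh : o.out h = false) : D.exit o T h = D.partner o T h := by
  obtain ⟨c, i⟩ := h
  unfold exit partner
  simp only [hh]
  split_ifs <;> simp_all

theorem walk_eq_next {h : D.End} (hh : o.out h = false) :
    D.walk o T h = D.next o T (D.next o T h) := by
  rw [next_of_in o T hh, next_of_out o T (by rw [out_partner, hh]; rfl), walk,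
    exit_eq_partner o T hh]

theorem walk_iterate {b : D.End} (hb : o.out b = false) (n : ℕ) :
    (D.walk o T)^[n] b = (D.next o T)^[2 * n] b ∧ o.out ((D.walk o T)^[n] b) = false := by
  induction n with
  | zero => exact ⟨rfl, hb⟩
  | succ n ih =>
    rw [Function.iterate_succ_apply', walk_eq_next o T ih.2, Nat.mul_succ,
      Function.iterate_succ_apply', Function.iterate_succ_apply', ← ih.1]
    exact ⟨rfl, by rw [out_next, out_next, ih.2]; rfl⟩

theorem out_next_iterate {b : D.End} (hb : o.out b = false) (n : ℕ) :
    o.out ((D.next o T)^[n] b) = decide (n % 2 = 1) := by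
  induction n with
  | zero => simpa using hb
  | succ n ih =>
    rw [Function.iterate_succ_apply', out_next, ih]
    rcases Nat.mod_two_eq_zero_or_one n with h | h <;> simp [h, Nat.add_mod]

/-- An incoming end reached end by end is reached by the walk. -/
theorem exists_walk_iterate {b h : D.End} (hb : o.out b = false) (hh : o.out h = false) {n : ℕ}
    (hn : (D.next o T)^[n] b = h) : ∃ m, n = 2 * m ∧ (D.walk o T)^[m] b = h := by
  have h1 := out_next_iterate o T hb n
  rw [hn, hh] at h1
  have h2 : n = 2 * (n / 2) := by
    have : ¬ n % 2 = 1 := by simpa using h1.symm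
    omega
  exact ⟨n / 2, h2, by rw [(walk_iterate o T hb _).1, ← h2, hn]⟩

theorem isSingleCurve_iff {b : D.End} (hb : o.out b = false) :
    D.IsSingleCurve o T b ↔ ∀ h, ∃ n, (D.next o T)^[n] b = h := by
  constructor
  · intro hs h
    cases hh : o.out h with
    | false =>
      obtain ⟨n, hn⟩ := hs h hh
      exact ⟨2 * n, by rw [← (walk_iterate o T hb n).1, hn]⟩
    | true =>
      obtain ⟨n, hn⟩ := hs (D.partner o T h) (by rw [out_partner, hh]; rfl)
      refine ⟨2 * n + 1, ?_⟩
      rw [Function.iterate_succ_apply', ← (walk_iterate o T hb n).1, hn,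
        next_of_in o T (by rw [out_partner, hh]; rfl), partner_partner]
  · intro hs h hh
    obtain ⟨n, hn⟩ := hs h
    obtain ⟨m, -, hm⟩ := exists_walk_iterate o T hb hh hn
    exact ⟨m, hm⟩

/-- `t` numbers the ends in the order in which they are met on the single closed curve obtained by
smoothing at `T`, starting from the end `b`. -/
structure IsTraversal (b : D.End) (t : D.End → ℕ) : Prop where
  inj : Function.Injective t
  zero : t b = 0
  succ : ∀ h, D.next o T h ≠ b → t (D.next o T h) = t h + 1
  last : ∀ h, D.next o T h = b → ∀ h', t h' ≤ t h
  le : ∀ n, t ((D.next o T)^[n] b) ≤ n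
  reach : ∀ h, (D.next o T)^[t h] b = h

theorem exists_isTraversal {b : D.End} (hs : ∀ h, ∃ n, (D.next o T)^[n] b = h) :
    ∃ t, IsTraversal o T b t := by
  classical
  have spec := fun h => Nat.find_spec (hs h)
  have mini : ∀ h n, (D.next o T)^[n] b = h → Nat.find (hs h) ≤ n :=
    fun h n hn => Nat.find_min' (hs h) hn
  refine ⟨fun h => Nat.find (hs h), ?_, ?_, ?_, ?_, fun n => mini _ n rfl, spec⟩
  · intro h h' e
    rw [← spec h, ← spec h']
    simp only at e
    rw [e]
  · exact Nat.le_zero.1 (mini b 0 rfl)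
  · intro h hne
    refine le_antisymm (mini _ _ ?_) ?_
    · rw [Function.iterate_succ_apply', spec h]
    · have h1 := spec (D.next o T h)
      rcases Nat.eq_zero_or_pos (Nat.find (hs (D.next o T h))) with h0 | h0
      · rw [h0] at h1
        exact absurd h1.symm hne
      · obtain ⟨m, hm⟩ := Nat.exists_eq_succ_of_ne_zero h0.ne'
        rw [hm, Function.iterate_succ_apply'] at h1
        have := mini h m (next_injective o T h1)
        omega
  · intro h hb h'
    by_contra hlt
    have e : Nat.find (hs h') = (Nat.find (hs h') - (Nat.find (hs h) + 1)) +
      (Nat.find (hs h) + 1) := by omega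
    have h1 := spec h'
    rw [e, Function.iterate_add_apply, Function.iterate_succ_apply', spec h, hb] at h1
    have := mini h' _ h1
    omega

/-! ### The order of the passages and its symmetries -/

/-- `1`, `0` or `-1` according to whether `p` is met before, together with, or after `q`. -/
def before (t : D.End → ℕ) (p q : D.End) : ℤ :=
  if t p < t q then 1 else if t q < t p then -1 else 0

/-- The order of two ends, signed by their directions. -/
def signedOrder (t : D.End → ℕ) (p q : D.End) : ℤ := o.dir p * o.dir q * before t p q

theorem signedOrder_swap (t : D.End → ℕ) (p q : D.End) :
    signedOrder o t q p = -signedOrder o t p q := by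
  unfold signedOrder before
  split_ifs <;> first | omega | ring

variable {o T}

theorem IsTraversal.signedOrder_next {b : D.End} {t : D.End → ℕ} (ht : IsTraversal o T b t)
    {p q : D.End} (hp : D.next o T p ≠ b) (h1 : q ≠ p) (h2 : q ≠ D.next o T p) :
    signedOrder o t (D.next o T p) q = -signedOrder o t p q := by
  have e := ht.succ p hp
  have n1 : t q ≠ t p := fun h => h1 (ht.inj h)
  have n2 : t q ≠ t (D.next o T p) := fun h => h2 (ht.inj h)
  unfold signedOrder before
  rw [dir_next]
  split_ifs <;> first | omega | ring

theorem IsTraversal.signedOrder_partner {b : D.End} (hb : o.out b = false) {t : D.End → ℕ}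
    (ht : IsTraversal o T b t) {p q : D.End} (h1 : q ≠ p) (h2 : q ≠ D.partner o T p) :
    signedOrder o t (D.partner o T p) q = -signedOrder o t p q := by
  cases hp : o.out p with
  | false =>
    rw [← next_of_in o T hp] at h2 ⊢
    refine ht.signedOrder_next (fun h => ?_) h1 h2
    have := out_next o T p
    rw [h, hb, hp] at this
    cases this
  | true =>
    have hp' : o.out (D.partner o T p) = false := by rw [out_partner, hp]; rfl
    have e : D.next o T (D.partner o T p) = p := by rw [next_of_in o T hp', partner_partner]
    have h3 := ht.signedOrder_next (p := D.partner o T p) (q := q)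
      (fun h => by rw [e] at h; rw [h, hb] at hp; cases hp) h2 (by rwa [e])
    rw [e] at h3
    rw [h3, neg_neg]

theorem IsTraversal.signedOrder_partner_self {b : D.End} (hb : o.out b = false) {t : D.End → ℕ}
    (ht : IsTraversal o T b t) (p : D.End) :
    signedOrder o t (D.partner o T p) p = -o.dir p := by
  have key : ∀ p, o.out p = false → t (D.partner o T p) = t p + 1 := by
    intro p hp
    have h := ht.succ p (fun h => by
      have := out_next o T p
      rw [h, hb, hp] at this
      cases this)
    rwa [next_of_in o T hp] at h
  unfold signedOrder before
  rw [dir_partner]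
  cases hp : o.out p with
  | false =>
    have := key p hp
    rw [if_neg (by omega), if_pos (by omega)]
    simp [Orientation.dir, hp]
  | true =>
    have := key (D.partner o T p) (by rw [out_partner, hp]; rfl)
    rw [partner_partner] at this
    rw [if_pos (by omega)]
    simp [Orientation.dir, hp]

/-- Summed over the two ends of an arc, the signed order with a third end does not depend on the
smoothing: it vanishes unless the arc carries the base point, and is then known. -/
theorem IsTraversal.signedOrder_mate {b : D.End} (hb : o.out b = false)
    {T' : Finset D.Crossing} {t t' : D.End → ℕ} (ht : IsTraversal o T b t)
    (ht' : IsTraversal o T' b t') (h q : D.End) :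
    signedOrder o t h q + signedOrder o t (D.mate h) q =
      signedOrder o t' h q + signedOrder o t' (D.mate h) q := by
  have base : ∀ {T : Finset D.Crossing} {t : D.End → ℕ}, IsTraversal o T b t → ∀ q,
      (q ≠ b → before t b q = 1) ∧ (q ≠ D.mate b → before t (D.mate b) q = -1) := by
    intro T t ht q
    have h0 := ht.zero
    have hm : o.out (D.mate b) = true := by rw [o.out_mate, hb]; rfl
    have h1 := ht.last (D.mate b) (by rw [next_of_out o T hm, D.mate_mate]) q
    constructor
    · intro hq
      have : t q ≠ t b := fun h => hq (ht.inj h)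
      exact if_pos (by omega)
    · intro hq
      have : t q ≠ t (D.mate b) := fun h => hq (ht.inj h)
      unfold before
      rw [if_neg (by omega), if_pos (by omega)]
  have self : ∀ {t : D.End → ℕ} q, before t q q = 0 := by
    intro t q; simp [before]
  have main : ∀ h, o.out h = true → signedOrder o t h q + signedOrder o t (D.mate h) q =
      signedOrder o t' h q + signedOrder o t' (D.mate h) q := by
    intro h hh
    by_cases hm : D.mate h = b
    · have hb' : h = D.mate b := by rw [← hm, D.mate_mate]
      subst hb'
      rw [D.mate_mate]
      unfold signedOrder
      by_cases h1 : q = b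
      · subst h1
        have hne := (D.mate_ne q).symm
        rw [((base ht q).2 hne), ((base ht' q).2 hne), self, self]
      · by_cases h2 : q = D.mate b
        · subst h2
          rw [((base ht _).1 h1), ((base ht' _).1 h1), self, self]
        · rw [((base ht _).1 h1), ((base ht' _).1 h1), ((base ht _).2 h2), ((base ht' _).2 h2)]
    · have e : ∀ T, D.next o T h = D.mate h := fun T => next_of_out o T hh
      by_cases h1 : q = h
      · subst h1
        have e1 := ht.succ q (by rwa [e])
        have e2 := ht'.succ q (by rwa [e])
        rw [e] at e1 e2
        simp [signedOrder, before, e1, e2]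
      · by_cases h2 : q = D.mate h
        · subst h2
          have e1 := ht.succ h (by rwa [e])
          have e2 := ht'.succ h (by rwa [e])
          rw [e] at e1 e2
          simp [signedOrder, before, e1, e2]
        · have e1 := ht.signedOrder_next (p := h) (q := q) (by rwa [e]) h1 (by rwa [e])
          have e2 := ht'.signedOrder_next (p := h) (q := q) (by rwa [e]) h1 (by rwa [e])
          rw [e] at e1 e2
          rw [e1, e2]
          ring
  cases hh : o.out h with
  | true => exact main h hh
  | false =>
    have := main (D.mate h) (by rw [o.out_mate, hh]; rfl)
    rw [D.mate_mate] at this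
    linarith

/-- As functions of one end, the signed orders with a fixed end are conserved at the crossings: the
two ends of each passage, smoothed or not, cancel. -/
theorem IsTraversal.sum_signedOrder {b : D.End} (hb : o.out b = false) {t : D.End → ℕ}
    (ht : IsTraversal o T b t) (x : D.Crossing) {q : D.End} (hq : q.1 ≠ x) :
    ∑ e : Fin 4, signedOrder o t (x, e) q = 0 := by
  have hx : ∀ e : Fin 4, (x, (D.partner o T (x, e)).2) = D.partner o T (x, e) := fun e =>
    Prod.ext (partner_fst o T (x, e)).symm rfl
  refine Finset.sum_involution (fun e _ => (D.partner o T (x, e)).2) ?_ ?_ ?_ ?_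
  · intro e _
    rw [hx, ht.signedOrder_partner hb, add_neg_cancel]
    · intro h; exact hq (by rw [h])
    · intro h; exact hq (by rw [h, partner_fst])
  · intro e _ _ h
    exact partner_ne o T (x, e) (by rw [← hx, h])
  · intro e _
    exact Finset.mem_univ _
  · intro e _
    simp only [hx, partner_partner]

/-- The sign that a crossing has when its first passage is the upper one.  For a crossing that is
not smoothed the choice of the ends `0` and `1` is immaterial, see
`IsTraversal.crossingOrder_corner`. -/
def crossingOrder (o : D.Orientation) (t : D.End → ℕ) (x : D.Crossing) : ℤ :=
  o.dir (x, 0) * o.dir (x, 1) * before t (x, 0) (x, 1)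

/-- The left side refers to the smoothing only through the signed orders; it picks out the crossings
that are not smoothed. -/
theorem IsTraversal.signedOrder_crossing {b : D.End} (hb : o.out b = false) {t : D.End → ℕ}
    (ht : IsTraversal o T b t) (x : D.Crossing) :
    signedOrder o t (x, 1) (x, 0) - signedOrder o t (x, 2) (x, 3) =
      if x ∈ T then 0 else -2 * crossingOrder o t x := by
  have ne : ∀ {i j : Fin 4}, i ≠ j → ((x, i) : D.End) ≠ (x, j) := fun h h' =>
    h (congrArg Prod.snd h')
  have o2 : o.out (x, 2) = !o.out (x, 0) := o.out_opp (x, 0)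
  have o3 : o.out (x, 3) = !o.out (x, 1) := o.out_opp (x, 1)
  have two : ∀ p0 p1 : Fin 4, D.partner o T (x, 0) = (x, p0) → D.partner o T (x, 1) = (x, p1) →
      p0 ≠ 1 → p1 ≠ 0 → p0 ≠ p1 →
      signedOrder o t (x, p1) (x, p0) = signedOrder o t (x, 1) (x, 0) := by
    intro p0 p1 h0 h1 n1 n2 n3
    have a1 : p0 ≠ 0 := fun h => partner_ne o T (x, 0) (by rw [h0, h])
    have a2 := ht.signedOrder_partner hb (p := (x, 1)) (q := (x, p0)) (ne n1)
      (by rw [h1]; exact ne n3)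
    have a3 := ht.signedOrder_partner hb (p := (x, 0)) (q := (x, 1)) (ne (by decide))
      (by rw [h0]; exact ne n1.symm)
    rw [h1] at a2
    rw [h0] at a3
    rw [a2, signedOrder_swap o t (x, p0), a3, signedOrder_swap o t (x, 1)]
    ring
  split_ifs with hx
  · by_cases h01 : o.out (x, 1) = o.out (x, 0)
    · rw [two 3 2 _ _ (by decide) (by decide) (by decide), sub_self]
      · simp [partner, hx, h01]
      · simp [partner, hx, h01, o2]
    · have e0 : D.partner o T (x, 0) = (x, 1) := by simp [partner, hx, h01]
      have e2 : D.partner o T (x, 2) = (x, 3) := by simp [partner, hx, o2, o3, h01]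
      have a0 := ht.signedOrder_partner_self hb (x, 0)
      have a2 := ht.signedOrder_partner_self hb (x, 2)
      rw [e0] at a0
      rw [e2] at a2
      rw [a0, signedOrder_swap o t (x, 3), a2]
      have : o.dir (x, 2) = -o.dir (x, 0) := o.dir_add_two x 0
      rw [this]
      ring
  · have a := two 2 3 (by simp [partner, hx, opp]) (by simp [partner, hx, opp]) (by decide)
      (by decide) (by decide)
    rw [signedOrder_swap o t (x, 3), a, signedOrder_swap o t (x, 0)]
    unfold crossingOrder signedOrder
    ring

end LinkDiagram

/-! ### Planarity of pretzel diagrams -/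

section PretzelArcs

variable {u : ℕ} (k : Fin u → ℤ) (hk : ∀ i, k i ≠ 0)

/-- The top crossing of a column. -/
def pretzelTop (i : Fin u) : PretzelCrossing k := ⟨i, ⟨0, Int.natAbs_pos.2 (hk i)⟩⟩

/-- The bottom crossing of a column. -/
def pretzelBot (i : Fin u) : PretzelCrossing k :=
  ⟨i, ⟨(k i).natAbs - 1, Nat.sub_lt (Int.natAbs_pos.2 (hk i)) one_pos⟩⟩

theorem pretzelMate_top (i : Fin u) :
    pretzelMate k hk (pretzelTop k hk i, 0) = (pretzelTop k hk (finRotate u i), 1) := by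
  simp [pretzelMate, pretzelTop]

theorem pretzelMate_bot (i : Fin u) :
    pretzelMate k hk (pretzelBot k hk i, 3) = (pretzelBot k hk (finRotate u i), 2) := by
  have := Int.natAbs_pos.2 (hk i)
  have h : ¬ (k i).natAbs - 1 + 1 < (k i).natAbs := by omega
  exact dif_neg h

theorem pretzelMate_two (i : Fin u) {j : ℕ} (h : j + 1 < (k i).natAbs) :
    pretzelMate k hk (⟨i, ⟨j, by omega⟩⟩, 2) = (⟨i, ⟨j + 1, h⟩⟩, 1) := by
  simp only [pretzelMate]
  rw [dif_pos h]

theorem pretzelMate_three (i : Fin u) {j : ℕ} (h : j + 1 < (k i).natAbs) :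
    pretzelMate k hk (⟨i, ⟨j, by omega⟩⟩, 3) = (⟨i, ⟨j + 1, h⟩⟩, 0) := by
  simp only [pretzelMate]
  rw [dif_pos h]

/-- An induction principle for the arcs of a pretzel diagram: a symmetric property of pairs of ends
holds for all arcs if it holds for the bridges and for the arcs inside the columns. -/
theorem pretzelMate_induction {P : PretzelCrossing k × Fin 4 → PretzelCrossing k × Fin 4 → Prop}
    (symm : ∀ h h', P h h' → P h' h)
    (top : ∀ i, P (pretzelTop k hk i, 0) (pretzelTop k hk (finRotate u i), 1))
    (bot : ∀ i, P (pretzelBot k hk i, 3) (pretzelBot k hk (finRotate u i), 2))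
    (left : ∀ i j (h : j + 1 < (k i).natAbs), P (⟨i, ⟨j, by omega⟩⟩, 2) (⟨i, ⟨j + 1, h⟩⟩, 1))
    (right : ∀ i j (h : j + 1 < (k i).natAbs), P (⟨i, ⟨j, by omega⟩⟩, 3) (⟨i, ⟨j + 1, h⟩⟩, 0))
    (h : PretzelCrossing k × Fin 4) : P h (pretzelMate k hk h) := by
  have three : ∀ x : PretzelCrossing k, P (x, 3) (pretzelMate k hk (x, 3)) := by
    rintro ⟨i, j, hj⟩
    by_cases h : j + 1 < (k i).natAbs
    · rw [pretzelMate_three k hk i h]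
      exact right i j h
    · have e : (⟨i, ⟨j, hj⟩⟩ : PretzelCrossing k) = pretzelBot k hk i :=
        pretzelCrossing_ext rfl _ _ (by simp only; omega)
      rw [e, pretzelMate_bot]
      exact bot i
  have zero : ∀ x : PretzelCrossing k, P (x, 0) (pretzelMate k hk (x, 0)) := by
    rintro ⟨i, j, hj⟩
    rcases j with _ | j
    · have := top i
      rw [← pretzelMate_top] at this
      exact this
    · have := right i j hj
      rw [← pretzelMate_three k hk i hj] at this ⊢
      rw [pretzelMate_mate]
      exact symm _ _ this
  obtain ⟨x, e⟩ := h
  have flip : ∀ y, P y (pretzelMate k hk y) → pretzelMate k hk y = (x, e) →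
      P (x, e) (pretzelMate k hk (x, e)) := by
    intro y hy e'
    rw [← e', pretzelMate_mate]
    exact symm _ _ hy
  fin_cases e
  · exact zero x
  · obtain ⟨i, j, hj⟩ := x
    rcases j with _ | j
    · refine flip (pretzelTop k hk ((finRotate u).symm i), 0) (zero _) ?_
      rw [pretzelMate_top]
      exact Prod.ext (pretzelCrossing_ext (Equiv.apply_symm_apply _ _) _ _ rfl) rfl
    · refine flip (⟨i, ⟨j, by omega⟩⟩, 2) ?_ (pretzelMate_two k hk i hj)
      rw [pretzelMate_two k hk i hj]
      exact left i j hj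
  · obtain ⟨i, j, hj⟩ := x
    by_cases h : j + 1 < (k i).natAbs
    · change P (⟨i, ⟨j, hj⟩⟩, 2) (pretzelMate k hk (⟨i, ⟨j, hj⟩⟩, 2))
      rw [pretzelMate_two k hk i h]
      exact left i j h
    · refine flip (pretzelBot k hk ((finRotate u).symm i), 3) (three _) ?_
      rw [pretzelMate_bot]
      refine Prod.ext (pretzelCrossing_ext (Equiv.apply_symm_apply _ _) _ _ ?_) rfl
      simp only [Equiv.apply_symm_apply]
      omega
  · exact three x

variable {k}

/-- The flow through the top of a crossing is the same along a column, if the flow is conserved at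
the crossings of the column. -/
theorem pretzel_column_flow {A : Type*} [AddCommGroup A] {g : PretzelCrossing k × Fin 4 → A}
    (hg : ∀ h, g (pretzelMate k hk h) = -g h) (i : Fin u)
    (hx : ∀ j, ∑ e, g (⟨i, j⟩, e) = 0) (j : Fin (k i).natAbs) :
    g (⟨i, j⟩, 1) + g (⟨i, j⟩, 0) =
      g (pretzelTop k hk i, 1) + g (pretzelTop k hk i, 0) := by
  obtain ⟨j, hj⟩ := j
  induction j with
  | zero => rfl
  | succ j ih =>
    rw [← ih (by omega), ← pretzelMate_two k hk i hj, ← pretzelMate_three k hk i hj, hg, hg]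
    have := hx ⟨j, by omega⟩
    rw [Fin.sum_univ_four] at this
    rw [← sub_eq_zero, ← neg_eq_zero, ← this]
    abel

theorem pretzel_column_flow_total {A : Type*} [AddCommGroup A] {g : PretzelCrossing k × Fin 4 → A}
    (hg : ∀ h, g (pretzelMate k hk h) = -g h) (i : Fin u)
    (hx : ∀ j, ∑ e, g (⟨i, j⟩, e) = 0) :
    g (pretzelTop k hk i, 1) + g (pretzelBot k hk i, 2) =
      g (pretzelTop k hk (finRotate u i), 1) + g (pretzelBot k hk (finRotate u i), 2) := by
  rw [← pretzelMate_top, ← pretzelMate_bot, hg, hg]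
  have h1 := pretzel_column_flow hk hg i hx ⟨(k i).natAbs - 1, (pretzelBot k hk i).2.isLt⟩
  have h2 := hx (pretzelBot k hk i).2
  rw [Fin.sum_univ_four] at h2
  change g (pretzelBot k hk i, 1) + g (pretzelBot k hk i, 0) = _ at h1
  change g (pretzelBot k hk i, 0) + g (pretzelBot k hk i, 1) + g (pretzelBot k hk i, 2) +
    g (pretzelBot k hk i, 3) = 0 at h2
  rw [add_comm (g (pretzelBot k hk i, 0)), h1] at h2
  rw [← sub_eq_zero, ← h2]
  abel

/-- A flow along the arcs of a pretzel diagram that is conserved at the crossings is the coboundary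
of a function on the regions of the plane.  Its value at the end `(x, e)` is the value at the region
between the ends `(x, e)` and `(x, e + 1)`. -/
theorem exists_pretzel_potential {g : PretzelCrossing k × Fin 4 → ℤ}
    (hg : ∀ h, g (pretzelMate k hk h) = -g h) (hx : ∀ x, ∑ e, g (x, e) = 0) :
    ∃ φ : PretzelCrossing k × Fin 4 → ℤ, (∀ x e, φ (x, e + 1) = φ (x, e) + g (x, e + 1)) ∧
      ∀ h, φ h = φ ((pretzelMate k hk h).1, (pretzelMate k hk h).2 + 3) := by
  let G : Fin u → ℤ := fun i => g (pretzelTop k hk i, 1)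
  let φ : PretzelCrossing k × Fin 4 → ℤ := fun h =>
    ![G h.1.1 - g (h.1, 1), G h.1.1, G h.1.1 + g (h.1, 2), G (finRotate u h.1.1)] h.2
  have e0 : ∀ x, φ (x, 0) = G x.1 - g (x, 1) := fun _ => rfl
  have e1 : ∀ x, φ (x, 1) = G x.1 := fun _ => rfl
  have e2 : ∀ x, φ (x, 2) = G x.1 + g (x, 2) := fun _ => rfl
  have e3 : ∀ x, φ (x, 3) = G (finRotate u x.1) := fun _ => rfl
  have hG : ∀ i, G (finRotate u i) = -g (pretzelTop k hk i, 0) := fun i => by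
    rw [← hg, pretzelMate_top]
  have hcol : ∀ x : PretzelCrossing k, g (x, 1) + g (x, 0) = G x.1 - G (finRotate u x.1) := by
    rintro ⟨i, j⟩
    rw [pretzel_column_flow hk hg i (fun j => hx _) j, hG]
    ring
  refine ⟨φ, ?_, ?_⟩
  · intro x e
    have h1 := hcol x
    have h2 := hx x
    rw [Fin.sum_univ_four] at h2
    fin_cases e
    · change φ (x, 1) = φ (x, 0) + g (x, 1)
      rw [e0, e1]; ring
    · change φ (x, 2) = φ (x, 1) + g (x, 2)
      rw [e1, e2]
    · change φ (x, 3) = φ (x, 2) + g (x, 3)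
      rw [e2, e3]; linarith
    · change φ (x, 0) = φ (x, 3) + g (x, 0)
      rw [e3, e0]; linarith
  · refine fun h => (pretzelMate_induction k hk (P := fun h h' =>
      φ h = φ (h'.1, h'.2 + 3) ∧ φ h' = φ (h.1, h.2 + 3)) ?_ ?_ ?_ ?_ ?_ h).1
    · exact fun h h' hh => hh.symm
    · intro i
      constructor
      · change φ (_, 0) = φ (_, 0)
        rw [e0, e0]
        exact (sub_self _).trans (sub_self _).symm
      · change φ (_, 1) = φ (_, 3)
        rw [e1, e3]
        rfl
    · intro i
      constructor
      · change φ (_, 3) = φ (_, 1)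
        rw [e1, e3]
        rfl
      · change φ (_, 2) = φ (_, 2)
        rw [e2, e2]
        exact (pretzel_column_flow_total hk hg i (fun j => hx _)).symm
    · intro i j h
      constructor
      · change φ (_, 2) = φ (_, 0)
        rw [e0, e2, ← pretzelMate_two k hk i h, hg, sub_neg_eq_add,
          pretzelMate_two k hk i h]
      · rfl
    · intro i j h
      constructor
      · rfl
      · change φ (_, 0) = φ (_, 2)
        rw [e0, e2, ← pretzelMate_two k hk i h, hg, sub_neg_eq_add]

theorem sum_telescope_fin {n : ℕ} (hn : 0 < n) (a c : Fin n → ℤ)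
    (h : ∀ j (hj : j + 1 < n), c ⟨j, by omega⟩ = -a ⟨j + 1, hj⟩) :
    ∑ j, (a j + c j) = a ⟨0, hn⟩ + c ⟨n - 1, by omega⟩ := by
  obtain ⟨m, rfl⟩ := Nat.exists_eq_succ_of_ne_zero hn.ne'
  rw [Finset.sum_add_distrib, Fin.sum_univ_succ, Fin.sum_univ_castSucc (f := c)]
  have : ∑ i : Fin m, c i.castSucc = -∑ i : Fin m, a i.succ := by
    rw [← Finset.sum_neg_distrib]
    exact Finset.sum_congr rfl fun i _ => h i.1 (by have := i.2; omega)
  rw [this]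
  change a ⟨0, hn⟩ + _ + (_ + c ⟨m, _⟩) = _
  simp only [Nat.succ_eq_add_one, Nat.add_sub_cancel]
  ring

theorem finRotate_ne_self (hu : 2 ≤ u) (i : Fin u) : finRotate u i ≠ i := by
  obtain ⟨n, rfl⟩ : ∃ n, u = n + 2 := ⟨u - 2, by omega⟩
  rw [finRotate_apply]
  simp

/-- The planarity of the pretzel diagram, in the form in which it enters the order of the passages:
an antisymmetric form on the ends that is a flow along the arcs in each variable, conserved at the
crossings away from the other variable, has total local self-intersection zero. -/
theorem pretzel_sum_form_eq_zero (hu : 2 ≤ u)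
    {R : PretzelCrossing k × Fin 4 → PretzelCrossing k × Fin 4 → ℤ}
    (hR : ∀ p q, R q p = -R p q) (hm : ∀ h q, R (pretzelMate k hk h) q = -R h q)
    (hx : ∀ x q, q.1 ≠ x → ∑ e, R (x, e) q = 0) :
    ∑ x : PretzelCrossing k, (R (x, 1) (x, 0) + R (x, 3) (x, 2)) = 0 := by
  have hm' : ∀ p h, R p (pretzelMate k hk h) = -R p h := fun p h => by
    rw [hR, hm, ← hR]
  have col : ∀ i q, q.1.1 ≠ i →
      R (pretzelTop k hk i, 1) q + R (pretzelBot k hk i, 2) q =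
      R (pretzelTop k hk (finRotate u i), 1) q + R (pretzelBot k hk (finRotate u i), 2) q :=
    fun i q hq => pretzel_column_flow_total hk (g := fun h => R h q) (fun h => hm h q) i
      (fun j => hx _ q fun h => hq (by rw [h]))
  -- The total flow through the arcs left of a column is the same for all columns, also when it is
  -- evaluated against these arcs themselves, which may be moved to the preceding column.
  have colTop : ∀ i, R (pretzelTop k hk i, 1) (pretzelTop k hk i, 1) +
      R (pretzelBot k hk i, 2) (pretzelTop k hk i, 1) =
      R (pretzelTop k hk (finRotate u i), 1) (pretzelTop k hk i, 1) +
      R (pretzelBot k hk (finRotate u i), 2) (pretzelTop k hk i, 1) := by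
    intro i
    have e : i = finRotate u ((finRotate u).symm i) := (Equiv.apply_symm_apply _ _).symm
    have := col i (pretzelTop k hk ((finRotate u).symm i), 0)
      (fun h => finRotate_ne_self hu _ (e.symm.trans h.symm))
    have e2 : ∀ p, R p (pretzelTop k hk i, 1) =
        -R p (pretzelTop k hk ((finRotate u).symm i), 0) := by
      intro p
      rw [← hm', pretzelMate_top, ← e]
    rw [e2, e2, e2, e2]
    linarith
  have self : ∀ p, R p p = 0 := fun p => by have := hR p p; omega
  rw [Fintype.sum_sigma]
  have hcol : ∀ i, ∑ j, (R (⟨i, j⟩, 1) (⟨i, j⟩, 0) + R (⟨i, j⟩, 3) (⟨i, j⟩, 2)) =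
      (R (pretzelBot k hk i, 2) (pretzelTop k hk i, 1)) -
      (R (pretzelBot k hk (finRotate u i), 2) (pretzelTop k hk (finRotate u i), 1)) := by
    intro i
    rw [sum_telescope_fin (Int.natAbs_pos.2 (hk i))
      (fun j => R (⟨i, j⟩, 1) (⟨i, j⟩, 0)) (fun j => R (⟨i, j⟩, 3) (⟨i, j⟩, 2))]
    · change R (pretzelTop k hk i, 1) (pretzelTop k hk i, 0) +
        R (pretzelBot k hk i, 3) (pretzelBot k hk i, 2) = _
      have ne := finRotate_ne_self hu i
      have a1 : R (pretzelTop k hk i, 1) (pretzelTop k hk i, 0) =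
          -R (pretzelTop k hk i, 1) (pretzelTop k hk (finRotate u i), 1) := by
        rw [← pretzelMate_top, hm', neg_neg]
      have a2 : R (pretzelBot k hk i, 3) (pretzelBot k hk i, 2) =
          R (pretzelBot k hk i, 2) (pretzelBot k hk (finRotate u i), 2) := by
        rw [← pretzelMate_bot, hm', hR]
      have b1 := col i (pretzelTop k hk (finRotate u i), 1) ne
      have b2 := col i (pretzelBot k hk (finRotate u i), 2) ne
      have b3 := colTop i
      rw [self] at b1 b2 b3
      have c1 := hR (pretzelTop k hk i, 1) (pretzelTop k hk (finRotate u i), 1)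
      have c2 := hR (pretzelTop k hk i, 1) (pretzelBot k hk (finRotate u i), 2)
      have c3 := hR (pretzelTop k hk (finRotate u i), 1) (pretzelBot k hk (finRotate u i), 2)
      rw [a1, a2]
      linarith
    · intro j hj
      rw [← pretzelMate_two k hk i hj, ← pretzelMate_three k hk i hj]
      simp only [hm, hm', neg_neg]
      rw [hR]
  rw [Finset.sum_congr rfl fun i _ => hcol i, Finset.sum_sub_distrib, sub_eq_zero]
  exact (Equiv.sum_comp (finRotate u)
    fun i => R (pretzelBot k hk i, 2) (pretzelTop k hk i, 1)).symm

end PretzelArcs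

namespace LinkDiagram

/-- The sum of the signs that the crossings outside of `T` have when their first passages are the
upper ones: the writhe, if the smoothed diagram is descending. -/
def totalOrder {D : LinkDiagram} (o : D.Orientation) (T : Finset D.Crossing) (t : D.End → ℕ) : ℤ :=
  ∑ x ∈ Tᶜ, crossingOrder o t x

theorem IsTraversal.totalOrder_eq {D : LinkDiagram} {o : D.Orientation} {T : Finset D.Crossing}
    {b : D.End} (hb : o.out b = false) {t : D.End → ℕ} (ht : IsTraversal o T b t) :
    -2 * totalOrder o T t =
      ∑ x, (signedOrder o t (x, 1) (x, 0) - signedOrder o t (x, 2) (x, 3)) := by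
  rw [Finset.sum_congr rfl fun x _ => ht.signedOrder_crossing hb x, totalOrder, Finset.mul_sum,
    ← Finset.sum_add_sum_compl T]
  have h0 : ∑ x ∈ T, (if x ∈ T then 0 else -2 * crossingOrder o t x) = 0 :=
    Finset.sum_eq_zero fun x hx => if_pos hx
  rw [h0, zero_add]
  exact Finset.sum_congr rfl fun x hx => (if_neg (Finset.mem_compl.1 hx)).symm

/-- On a pretzel diagram the total order is the same for all smoothings to a single curve: the
difference of the signed orders of two of them is a form to which the planarity of the diagram
applies. -/
theorem totalOrder_pretzel {u : ℕ} (hu : 2 ≤ u) (k : Fin u → ℤ) (hk : ∀ i, k i ≠ 0)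
    (o : (pretzel k hk).Orientation) {b : (pretzel k hk).End} (hb : o.out b = false)
    {T T' : Finset (pretzel k hk).Crossing} {t t' : (pretzel k hk).End → ℕ}
    (ht : IsTraversal o T b t) (ht' : IsTraversal o T' b t') :
    totalOrder o T t = totalOrder o T' t' := by
  have h1 := ht.totalOrder_eq hb
  have h2 := ht'.totalOrder_eq hb
  let R : (pretzel k hk).End → (pretzel k hk).End → ℤ := fun p q =>
    signedOrder o t p q - signedOrder o t' p q
  have hR : ∀ p q, R q p = -R p q := fun p q => by
    simp only [R, signedOrder_swap o t p, signedOrder_swap o t' p]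
    ring
  have hm : ∀ h q, R ((pretzel k hk).mate h) q = -R h q := fun h q => by
    have := ht.signedOrder_mate hb ht' h q
    simp only [R]
    linarith
  have hx : ∀ x q, q.1 ≠ x → ∑ e, R (x, e) q = 0 := fun x q hq => by
    simp only [R]
    rw [Finset.sum_sub_distrib, ht.sum_signedOrder hb x hq, ht'.sum_signedOrder hb x hq, sub_self]
  have h3 : ∑ x, (R (x, 1) (x, 0) + R (x, 3) (x, 2)) = 0 :=
    pretzel_sum_form_eq_zero hk hu hR hm hx
  have h4 : ∑ x, (signedOrder o t (x, 1) (x, 0) - signedOrder o t (x, 2) (x, 3)) -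
      ∑ x, (signedOrder o t' (x, 1) (x, 0) - signedOrder o t' (x, 2) (x, 3)) = 0 := by
    rw [← Finset.sum_sub_distrib, ← h3]
    refine Finset.sum_congr rfl fun x _ => ?_
    simp only [R]
    rw [signedOrder_swap o t (x, 3), signedOrder_swap o t' (x, 3)]
    ring
  omega

end LinkDiagram

namespace LinkDiagram

/-! ### The Fox matrix of a smoothed diagram -/

variable {D : LinkDiagram}

/-- At every crossing two neighbouring ends are incoming.  The crossing then has the incoming ends
`(c, i)`, `(c, i + 1)` and the outgoing ends `(c, i + 2)`, `(c, i + 3)`. -/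
theorem Orientation.exists_corner (o : D.Orientation) (c : D.Crossing) :
    ∃ i : Fin 4, o.out (c, i) = false ∧ o.out (c, i + 1) = false := by
  have h2 : o.out (c, 2) = !o.out (c, 0) := o.out_opp (c, 0)
  have h3 : o.out (c, 3) = !o.out (c, 1) := o.out_opp (c, 1)
  cases h0 : o.out (c, 0) <;> cases h1 : o.out (c, 1)
  · exact ⟨0, h0, h1⟩
  · exact ⟨3, by rw [h3, h1]; rfl, h0⟩
  · exact ⟨1, h1, by rw [show (1 : Fin 4) + 1 = 2 from rfl, h2, h0]; rfl⟩
  · exact ⟨2, by rw [h2, h0]; rfl, by rw [show (2 : Fin 4) + 1 = 3 from rfl, h3, h1]; rfl⟩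

theorem fin_four_cases (i j : Fin 4) : j = i ∨ j = i + 1 ∨ j = i + 2 ∨ j = i + 3 := by
  revert i j; decide

theorem isOver_add_one (c : D.Crossing) (i : Fin 4) : D.IsOver (c, i + 1) ↔ ¬ D.IsOver (c, i) := by
  unfold IsOver
  fin_cases i <;> simp

theorem isOver_add_two (c : D.Crossing) (i : Fin 4) : D.IsOver (c, i + 2) ↔ D.IsOver (c, i) := by
  unfold IsOver
  fin_cases i <;> simp

theorem isOver_add_three (c : D.Crossing) (i : Fin 4) :
    D.IsOver (c, i + 3) ↔ ¬ D.IsOver (c, i) := by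
  unfold IsOver
  fin_cases i <;> simp

open Classical in
theorem sign_corner (o : D.Orientation) {c : D.Crossing} {i : Fin 4}
    (h0 : o.out (c, i) = false) (h1 : o.out (c, i + 1) = false) :
    D.sign o c = if D.IsOver (c, i) then 1 else -1 := by
  unfold sign
  congr 1
  refine propext ⟨?_, fun h => ⟨i + 2, (isOver_add_two c i).2 h, ?_, ?_⟩⟩
  · rintro ⟨j, hj, hj0, hj1⟩
    rcases fin_four_cases i j with rfl | rfl | rfl | rfl
    · rw [h0] at hj0; cases hj0
    · rw [h1] at hj0; cases hj0
    · exact (isOver_add_two c i).1 hj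
    · have : i + 3 + 1 = i := by rw [add_assoc]; exact add_zero i
      rw [this, h0] at hj1; cases hj1
  · rw [o.out_add_two, h0]; rfl
  · have : i + 2 + 1 = i + 3 := by rw [add_assoc]; rfl
    rw [this, o.out_add_three, h1]; rfl

/-- The incoming neighbour of an outgoing end. -/
def inNbr (o : D.Orientation) (h : D.End) : D.End :=
  if o.out (h.1, h.2 + 1) = true then (h.1, h.2 + 3) else (h.1, h.2 + 1)

open Classical in
/-- The Fox relation at the end `h`, solved for the value at `h`: the value at an incoming end comes
along the arc, the value at an outgoing end through the crossing, and the value at the base point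
`b` is zero.  The parameter of the Alexander polynomial is `q ^ 2`. -/
noncomputable def foxRow (q : ℝ) (D : LinkDiagram) (o : D.Orientation) (T : Finset D.Crossing)
    (b h : D.End) : D.End → ℝ :=
  if h = b then 0
  else if o.out h = true then
    if h.1 ∈ T then Pi.single (inNbr o h) 1
    else if D.IsOver h then Pi.single (D.opp h) 1
    else (q ^ 2) ^ D.sign o h.1 • Pi.single (D.opp h) 1 +
      (1 - (q ^ 2) ^ D.sign o h.1) • Pi.single (inNbr o h) 1
  else Pi.single (D.mate h) 1

/-- The matrix of the Fox relations. -/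
noncomputable def foxMatrix (q : ℝ) (D : LinkDiagram) (o : D.Orientation) (T : Finset D.Crossing)
    (b : D.End) : Matrix D.End D.End ℝ :=
  fun h => Pi.single h 1 - foxRow q D o T b h

/-- The determinant of the Fox matrix, normalized by a power of `q` at the crossings. -/
noncomputable def foxDet (q : ℝ) (D : LinkDiagram) (o : D.Orientation) (T : Finset D.Crossing)
    (b : D.End) : ℝ :=
  (∏ c ∈ Tᶜ, q ^ (-D.sign o c)) * (foxMatrix q D o T b).det

section Rows

variable {o : D.Orientation} {T : Finset D.Crossing} {b : D.End} (q : ℝ)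

theorem foxRow_base : foxRow q D o T b b = 0 := if_pos rfl

theorem foxRow_in {h : D.End} (hb : h ≠ b) (hh : o.out h = false) :
    foxRow q D o T b h = Pi.single (D.mate h) 1 := by
  simp [foxRow, hb, hh]

variable {c : D.Crossing} {i : Fin 4}

theorem foxRow_smoothed (hb : o.out b = false) (h0 : o.out (c, i) = false)
    (h1 : o.out (c, i + 1) = false) (hc : c ∈ T) :
    foxRow q D o T b (c, i + 2) = Pi.single (c, i + 1) 1 ∧
      foxRow q D o T b (c, i + 3) = Pi.single (c, i) 1 := by
  have e0 : i + 3 + 1 = i := by rw [add_assoc]; exact add_zero i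
  have e1 : i + 2 + 1 = i + 3 := by rw [add_assoc]; rfl
  have e2 : i + 2 + 3 = i + 1 := by rw [add_assoc]; rfl
  have o2 : o.out (c, i + 2) = true := by rw [o.out_add_two, h0]; rfl
  have o3 : o.out (c, i + 3) = true := by rw [o.out_add_three, h1]; rfl
  have n2 : (c, i + 2) ≠ b := fun h => by rw [h, hb] at o2; cases o2
  have n3 : (c, i + 3) ≠ b := fun h => by rw [h, hb] at o3; cases o3
  simp [foxRow, n2, n3, o2, o3, hc, inNbr, e0, e1, e2, h0]

theorem foxRow_pos (hb : o.out b = false) (h0 : o.out (c, i) = false)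
    (h1 : o.out (c, i + 1) = false) (hc : c ∉ T) (ho : D.IsOver (c, i)) :
    foxRow q D o T b (c, i + 2) = Pi.single (c, i) 1 ∧
      foxRow q D o T b (c, i + 3) =
        q ^ 2 • Pi.single (c, i + 1) 1 + (1 - q ^ 2) • Pi.single (c, i) 1 := by
  have e0 : i + 3 + 1 = i := by rw [add_assoc]; exact add_zero i
  have e2 : i + 2 + 2 = i := by rw [add_assoc]; exact add_zero i
  have e3 : i + 3 + 2 = i + 1 := by rw [add_assoc]; rfl
  have o2 : o.out (c, i + 2) = true := by rw [o.out_add_two, h0]; rfl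
  have o3 : o.out (c, i + 3) = true := by rw [o.out_add_three, h1]; rfl
  have n2 : (c, i + 2) ≠ b := fun h => by rw [h, hb] at o2; cases o2
  have n3 : (c, i + 3) ≠ b := fun h => by rw [h, hb] at o3; cases o3
  simp [foxRow, n2, n3, o2, o3, hc, inNbr, e0, opp, e2, e3, h0, isOver_add_two, isOver_add_three,
    ho, sign_corner o h0 h1]

theorem foxRow_neg (hb : o.out b = false) (h0 : o.out (c, i) = false)
    (h1 : o.out (c, i + 1) = false) (hc : c ∉ T) (ho : ¬ D.IsOver (c, i)) :
    foxRow q D o T b (c, i + 2) =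
        (q ^ 2)⁻¹ • Pi.single (c, i) 1 + (1 - (q ^ 2)⁻¹) • Pi.single (c, i + 1) 1 ∧
      foxRow q D o T b (c, i + 3) = Pi.single (c, i + 1) 1 := by
  have e1 : i + 2 + 1 = i + 3 := by rw [add_assoc]; rfl
  have e2 : i + 2 + 2 = i := by rw [add_assoc]; exact add_zero i
  have e3 : i + 3 + 2 = i + 1 := by rw [add_assoc]; rfl
  have e4 : i + 2 + 3 = i + 1 := by rw [add_assoc]; rfl
  have o2 : o.out (c, i + 2) = true := by rw [o.out_add_two, h0]; rfl
  have o3 : o.out (c, i + 3) = true := by rw [o.out_add_three, h1]; rfl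
  have n2 : (c, i + 2) ≠ b := fun h => by rw [h, hb] at o2; cases o2
  have n3 : (c, i + 3) ≠ b := fun h => by rw [h, hb] at o3; cases o3
  simp [foxRow, n2, n3, o2, o3, hc, inNbr, e1, opp, e2, e3, e4, isOver_add_two,
    isOver_add_three, ho, sign_corner o h0 h1]

end Rows

/-! ### The skein relation for the Fox determinant -/

/-- The skein relation for three matrices that differ in two rows as the Fox matrices of a positive,
a negative and a smoothed crossing do. -/
theorem det_skein_rows {ι : Type*} [Fintype ι] [DecidableEq ι] {q : ℝ} (hq : q ≠ 0)
    {P N Z : Matrix ι ι ℝ} {x' y' : ι} (hxy : x' ≠ y') {x y l r : ι → ℝ}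
    (hP : ∀ h, h ≠ x' → h ≠ y' → P h = Z h) (hN : ∀ h, h ≠ x' → h ≠ y' → N h = Z h)
    (hP1 : P x' = x - l) (hP2 : P y' = y - (q ^ 2 • r + (1 - q ^ 2) • l))
    (hN1 : N x' = x - ((q ^ 2)⁻¹ • l + (1 - (q ^ 2)⁻¹) • r)) (hN2 : N y' = y - r)
    (hZ1 : Z x' = x - r) (hZ2 : Z y' = y - l) :
    q⁻¹ * P.det - q * N.det = (q⁻¹ - q) * Z.det := by
  let f : (ι → ℝ) → (ι → ℝ) → ℝ := fun v w => ((Z.updateRow x' v).updateRow y' w).det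
  have key : ∀ M : Matrix ι ι ℝ, (∀ h, h ≠ x' → h ≠ y' → M h = Z h) → M.det = f (M x') (M y') := by
    intro M hM
    simp only [f]
    congr 1
    ext h j
    by_cases h1 : h = y'
    · subst h1; simp
    · by_cases h2 : h = x'
      · subst h2; simp [Matrix.updateRow_ne h1]
      · rw [Matrix.updateRow_ne h1, Matrix.updateRow_ne h2, hM h h2 h1]
  have add2 : ∀ v w w', f v (w + w') = f v w + f v w' := fun v w w' => Matrix.det_updateRow_add ..
  have smul2 : ∀ v (a : ℝ) w, f v (a • w) = a * f v w := fun v a w => Matrix.det_updateRow_smul ..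
  have self : ∀ v, f v v = 0 := fun v =>
    Matrix.det_zero_of_row_eq hxy (by simp [Matrix.updateRow_ne hxy])
  have comm : ∀ v w, f v w = ((Z.updateRow y' w).updateRow x' v).det := fun v w => by
    simp only [f]
    rw [Matrix.updateRow_comm _ hxy]
  have add1 : ∀ v v' w, f (v + v') w = f v w + f v' w := fun v v' w => by
    rw [comm, comm, comm, Matrix.det_updateRow_add]
  have smul1 : ∀ (a : ℝ) v w, f (a • v) w = a * f v w := fun a v w => by
    rw [comm, comm, Matrix.det_updateRow_smul]
  have anti : ∀ v w, f w v = -f v w := fun v w => by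
    have := self (v + w)
    rw [add1, add2, add2, self, self] at this
    linarith
  rw [key P hP, key N hN, key Z fun _ _ _ => rfl, hP1, hP2, hN1, hN2, hZ1, hZ2]
  simp only [sub_eq_add_neg, ← neg_one_smul ℝ (_ : ι → ℝ), add1, add2, smul1, smul2, self, anti l r]
  field_simp
  ring

theorem compl_eq_insert_compl_insert {α : Type*} [Fintype α] [DecidableEq α] {T : Finset α} {c : α}
    (hc : c ∉ T) : Tᶜ = insert c (insert c T)ᶜ := by
  ext x
  by_cases hx : x = c <;> simp [hx, hc]

theorem foxRow_switch_of_ne (q : ℝ) {o : D.Orientation} {T : Finset D.Crossing} {b : D.End}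
    (hb : o.out b = false) {c : D.Crossing} {h : D.End} (hc : h.1 ≠ c) :
    foxRow q (D.switch c) (o.switch c) T b h = foxRow q D o T b h := by
  obtain ⟨x, j⟩ := h
  by_cases hbb : (x, j) = b
  · rw [hbb, foxRow_base]
    exact foxRow_base q
  · cases ho : o.out (x, j) with
    | false =>
      rw [foxRow_in q hbb ho]
      exact foxRow_in (o := o.switch c) q hbb ho
    | true =>
      obtain ⟨i, h0, h1⟩ := o.exists_corner x
      have key : foxRow q (D.switch c) (o.switch c) T b (x, i + 2) = foxRow q D o T b (x, i + 2) ∧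
          foxRow q (D.switch c) (o.switch c) T b (x, i + 3) =
            foxRow q D o T b (x, i + 3) := by
        have hv := D.isOver_switch_of_ne (x, i) hc
        by_cases hx : x ∈ T
        · have a := foxRow_smoothed q hb h0 h1 hx
          have a' := foxRow_smoothed (D := D.switch c) (o := o.switch c) q hb h0 h1 hx
          exact ⟨a'.1.trans a.1.symm, a'.2.trans a.2.symm⟩
        · by_cases hv' : D.IsOver (x, i)
          · have a := foxRow_pos q hb h0 h1 hx hv'
            have a' := foxRow_pos (D := D.switch c) (o := o.switch c) q hb h0 h1 hx (hv.2 hv')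
            exact ⟨a'.1.trans a.1.symm, a'.2.trans a.2.symm⟩
          · have a := foxRow_neg q hb h0 h1 hx hv'
            have a' := foxRow_neg (D := D.switch c) (o := o.switch c) q hb h0 h1 hx
              (fun h => hv' (hv.1 h))
            exact ⟨a'.1.trans a.1.symm, a'.2.trans a.2.symm⟩
      rcases fin_four_cases i j with rfl | rfl | rfl | rfl
      · rw [h0] at ho; cases ho
      · rw [h1] at ho; cases ho
      · exact key.1
      · exact key.2

/-- The Fox determinant obeys the skein relation of the Conway polynomial with `z = q⁻¹ - q`. -/
theorem foxDet_skein {q : ℝ} (hq : q ≠ 0) {o : D.Orientation} {T : Finset D.Crossing} {b : D.End}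
    (hb : o.out b = false) {c : D.Crossing} (hc : c ∉ T) :
    foxDet q D o T b - foxDet q (D.switch c) (o.switch c) T b =
      D.sign o c * (q⁻¹ - q) * foxDet q D o (insert c T) b := by
  obtain ⟨i, h0, h1⟩ := o.exists_corner c
  have hcc : c ∈ insert c T := Finset.mem_insert_self c T
  have hne : ((c, i + 2) : D.End) ≠ (c, i + 3) := fun h => by
    have := congrArg Prod.snd h
    simp at this
  have off : ∀ h : D.End, h ≠ (c, i + 2) → h ≠ (c, i + 3) →
      foxRow q D o T b h = foxRow q D o (insert c T) b h ∧
      foxRow q (D.switch c) (o.switch c) T b h = foxRow q D o (insert c T) b h := by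
    intro h hx hy
    have hmem : o.out h = true → h.1 ≠ c := by
      rintro ho rfl
      rcases fin_four_cases i h.2 with e | e | e | e
      · rw [← e] at h0; rw [h0] at ho; cases ho
      · rw [← e] at h1; rw [h1] at ho; cases ho
      · exact hx (by rw [← e])
      · exact hy (by rw [← e])
    have e : foxRow q D o T b h = foxRow q D o (insert c T) b h := by
      by_cases hbb : h = b
      · rw [hbb, foxRow_base, foxRow_base]
      · cases ho : o.out h with
        | false => rw [foxRow_in q hbb ho, foxRow_in q hbb ho]
        | true => simp [foxRow, hbb, ho, hmem ho]
    refine ⟨e, ?_⟩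
    by_cases hn : h.1 = c
    · have ho : o.out h = false := by
        cases ho : o.out h with
        | false => rfl
        | true => exact absurd hn (hmem ho)
      by_cases hbb : h = b
      · rw [hbb, foxRow_base]
        exact foxRow_base q
      · rw [foxRow_in q hbb ho]
        exact foxRow_in (o := o.switch c) q hbb ho
    · exact (foxRow_switch_of_ne q hb hn).trans e
  have hs := sign_corner o h0 h1
  let s' : D.Crossing → ℤ := fun x => (D.switch c).sign (o.switch c) x
  have hw : ∏ x ∈ (insert c T)ᶜ, q ^ (-s' x) = ∏ x ∈ (insert c T)ᶜ, q ^ (-D.sign o x) := by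
    refine Finset.prod_congr rfl fun x hx => ?_
    have hx' : x ≠ c := by
      rintro rfl
      exact Finset.mem_compl.1 hx hcc
    have : s' x = D.sign o x := D.sign_switch_of_ne o hx'
    rw [this]
  have hcn : c ∉ (insert c T)ᶜ := by simp
  have f1 : foxDet q D o T b = q ^ (-D.sign o c) *
      (∏ x ∈ (insert c T)ᶜ, q ^ (-D.sign o x)) * (foxMatrix q D o T b).det := by
    rw [foxDet, compl_eq_insert_compl_insert hc, Finset.prod_insert hcn]
  have f2 : foxDet q (D.switch c) (o.switch c) T b = q ^ D.sign o c *
      (∏ x ∈ (insert c T)ᶜ, q ^ (-D.sign o x)) *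
        (foxMatrix q (D.switch c) (o.switch c) T b).det := by
    have e1 : foxDet q (D.switch c) (o.switch c) T b = (∏ x ∈ (Tᶜ : Finset D.Crossing),
      q ^ (-s' x)) * (foxMatrix q (D.switch c) (o.switch c) T b).det := rfl
    have e2 : s' c = -D.sign o c := D.sign_switch_self o c
    rw [e1, compl_eq_insert_compl_insert hc, Finset.prod_insert hcn, hw, e2, neg_neg]
  rw [f1, f2, foxDet]
  have z := foxRow_smoothed q hb h0 h1 hcc
  let row : D.End → (D.End → ℝ) → D.End → ℝ := fun h v => Pi.single h 1 - v
  by_cases ho : D.IsOver (c, i)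
  · have p := foxRow_pos q hb h0 h1 hc ho
    have n := foxRow_neg (D := D.switch c) (o := o.switch c) q hb h0 h1 hc
      (fun h => (D.isOver_switch_self (c, i) rfl).1 h ho)
    have := det_skein_rows hq (P := foxMatrix q D o T b)
      (N := foxMatrix q (D.switch c) (o.switch c) T b) (Z := foxMatrix q D o (insert c T) b) hne
      (x := Pi.single (c, i + 2) 1) (y := Pi.single (c, i + 3) 1) (l := Pi.single (c, i) 1)
      (r := Pi.single (c, i + 1) 1)
      (fun h hx hy => congrArg (row h) (off h hx hy).1)
      (fun h hx hy => congrArg (row h) (off h hx hy).2)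
      (congrArg (row (c, i + 2)) p.1) (congrArg (row (c, i + 3)) p.2)
      (congrArg (row (c, i + 2)) n.1) (congrArg (row (c, i + 3)) n.2)
      (congrArg (row (c, i + 2)) z.1) (congrArg (row (c, i + 3)) z.2)
    rw [hs, if_pos ho]
    have fin : ∀ a a' z w : ℝ, q⁻¹ * a - q * a' = (q⁻¹ - q) * z →
        q ^ (-1 : ℤ) * w * a - q ^ (1 : ℤ) * w * a' = ((1 : ℤ) : ℝ) * (q⁻¹ - q) * (w * z) := by
      intro a a' z w h
      rw [zpow_neg_one, zpow_one, Int.cast_one]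
      linear_combination w * h
    exact fin _ _ _ _ this
  · have n := foxRow_neg q hb h0 h1 hc ho
    have p := foxRow_pos (D := D.switch c) (o := o.switch c) q hb h0 h1 hc
      ((D.isOver_switch_self (c, i) rfl).2 ho)
    have := det_skein_rows hq (N := foxMatrix q D o T b)
      (P := foxMatrix q (D.switch c) (o.switch c) T b) (Z := foxMatrix q D o (insert c T) b) hne
      (x := Pi.single (c, i + 2) 1) (y := Pi.single (c, i + 3) 1) (l := Pi.single (c, i) 1)
      (r := Pi.single (c, i + 1) 1)
      (fun h hx hy => congrArg (row h) (off h hx hy).2)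
      (fun h hx hy => congrArg (row h) (off h hx hy).1)
      (congrArg (row (c, i + 2)) p.1) (congrArg (row (c, i + 3)) p.2)
      (congrArg (row (c, i + 2)) n.1) (congrArg (row (c, i + 3)) n.2)
      (congrArg (row (c, i + 2)) z.1) (congrArg (row (c, i + 3)) z.2)
    rw [hs, if_neg ho]
    have fin : ∀ a a' z w : ℝ, q⁻¹ * a' - q * a = (q⁻¹ - q) * z →
        q ^ (- -1 : ℤ) * w * a - q ^ (-1 : ℤ) * w * a' =
          ((-1 : ℤ) : ℝ) * (q⁻¹ - q) * (w * z) := by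
      intro a a' z w h
      rw [neg_neg, zpow_neg_one, zpow_one, Int.cast_neg, Int.cast_one]
      linear_combination (-w) * h
    exact fin _ _ _ _ this

end LinkDiagram

namespace LinkDiagram

/-! ### Descending diagrams -/

variable {D : LinkDiagram} {o : D.Orientation} {T : Finset D.Crossing} {b : D.End}

/-- If the walk meets the under-strand of a crossing, but not as the first passage, then it has met
the over-strand before. -/
theorem exists_over_of_not_firstUnder (hb : o.out b = false) {c : D.Crossing}
    (hd : ¬ D.FirstUnder o T b c) {n : ℕ} (hn : ((D.walk o T)^[n] b).1 = c)
    (hu : ¬ D.IsOver ((D.walk o T)^[n] b)) :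
    ∃ m < n, ((D.walk o T)^[m] b).1 = c ∧ D.IsOver ((D.walk o T)^[m] b) ∧
      o.out ((D.walk o T)^[m] b) = false := by
  classical
  have hex : ∃ m, ((D.walk o T)^[m] b).1 = c := ⟨n, hn⟩
  have hov : D.IsOver ((D.walk o T)^[Nat.find hex] b) := by
    by_contra h
    exact hd ⟨_, Nat.find_spec hex, h, fun m hm => Nat.find_min hex hm⟩
  refine ⟨Nat.find hex, lt_of_le_of_ne (Nat.find_min' hex hn) ?_, Nat.find_spec hex, hov,
    (walk_iterate o T hb _).2⟩
  intro h
  rw [h] at hov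
  exact hu hov

/-- Two incoming ends of a crossing on the over-strand are equal. -/
theorem eq_of_isOver_of_in {h h' : D.End} (hc : h.1 = h'.1) (ho : D.IsOver h) (ho' : D.IsOver h')
    (hi : o.out h = false) (hi' : o.out h' = false) : h = h' := by
  obtain ⟨c, i⟩ := h
  obtain ⟨c', j⟩ := h'
  simp only at hc
  subst hc
  rcases fin_four_cases i j with rfl | rfl | rfl | rfl
  · rfl
  · exact absurd ho ((isOver_add_one c i).1 ho')
  · rw [o.out_add_two, hi] at hi'; cases hi'
  · exact absurd ho ((isOver_add_three c i).1 ho')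

/-- On a descending single curve the over-strand of a crossing is met before the under-strand. -/
theorem IsTraversal.lt_of_descending (hb : o.out b = false) {t : D.End → ℕ}
    (ht : IsTraversal o T b t) {h h' : D.End} (hd : ¬ D.FirstUnder o T b h.1)
    (hc : h.1 = h'.1) (ho : D.IsOver h) (hu : ¬ D.IsOver h') (hi : o.out h = false)
    (hi' : o.out h' = false) : t h < t h' := by
  obtain ⟨n, hn, hw⟩ := exists_walk_iterate o T hb hi' (ht.reach h')
  obtain ⟨m, hm, h1, h2, h3⟩ := exists_over_of_not_firstUnder hb hd (n := n) (by rw [hw, hc])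
    (by rwa [hw])
  have e := eq_of_isOver_of_in (o := o) h1 h2 ho h3 hi
  have := ht.le (2 * m)
  rw [← (walk_iterate o T hb m).1, e] at this
  omega

theorem IsTraversal.crossingOrder_corner (hb : o.out b = false) {t : D.End → ℕ}
    (ht : IsTraversal o T b t) {c : D.Crossing} (hc : c ∉ T) {i : Fin 4}
    (h0 : o.out (c, i) = false) (h1 : o.out (c, i + 1) = false) :
    crossingOrder o t c = before t (c, i) (c, i + 1) := by
  have e : signedOrder o t (c, i) (c, i + 1) = before t (c, i) (c, i + 1) := by
    simp [signedOrder, Orientation.dir, h0, h1]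
  have ne : ∀ {i j : Fin 4}, i ≠ j → ((c, i) : D.End) ≠ (c, j) := fun h h' =>
    h (congrArg Prod.snd h')
  have p : ∀ i j : Fin 4, j ≠ i → j ≠ i + 2 →
      signedOrder o t (c, i + 2) (c, j) = -signedOrder o t (c, i) (c, j) := by
    intro i j n1 n2
    have hp : D.partner o T (c, i) = (c, i + 2) := by simp [partner, hc, opp]
    have := ht.signedOrder_partner hb (p := (c, i)) (q := (c, j)) (ne n1) (by rw [hp]; exact ne n2)
    rwa [hp] at this
  have p0 := p 0 1 (by decide) (by decide)
  have p1 := p 1 2 (by decide) (by decide)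
  have p3 := p 1 0 (by decide) (by decide)
  change signedOrder o t (c, 2) (c, 1) = _ at p0
  change signedOrder o t (c, 3) (c, 2) = _ at p1
  change signedOrder o t (c, 3) (c, 0) = _ at p3
  have s1 := signedOrder_swap o t (c, 0) (c, 1)
  have s2 := signedOrder_swap o t (c, 1) (c, 2)
  have s3 := signedOrder_swap o t (c, 2) (c, 3)
  rw [← e]
  change signedOrder o t (c, 0) (c, 1) = _
  fin_cases i
  · rfl
  · change _ = signedOrder o t (c, 1) (c, 2)
    linarith
  · change _ = signedOrder o t (c, 2) (c, 3)
    linarith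
  · change _ = signedOrder o t (c, 3) (c, 0)
    linarith

open Classical in
theorem IsTraversal.sign_eq_crossingOrder (hb : o.out b = false) {t : D.End → ℕ}
    (ht : IsTraversal o T b t) {c : D.Crossing} (hc : c ∉ T) (hd : ¬ D.FirstUnder o T b c) :
    D.sign o c = crossingOrder o t c := by
  obtain ⟨i, h0, h1⟩ := o.exists_corner c
  rw [sign_corner o h0 h1, ht.crossingOrder_corner hb hc h0 h1]
  unfold before
  by_cases hv : D.IsOver (c, i)
  · have := ht.lt_of_descending hb (h := (c, i)) (h' := (c, i + 1)) hd rfl hv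
      (fun h => (isOver_add_one c i).1 h hv) h0 h1
    simp [hv, this]
  · have := ht.lt_of_descending hb (h := (c, i + 1)) (h' := (c, i)) hd rfl
      ((isOver_add_one c i).2 hv) hv h1 h0
    rw [if_neg hv, if_neg (by omega), if_pos this]

/-- The Fox matrix of a descending single curve is triangular with respect to the order in which the
ends are met. -/
theorem IsTraversal.foxRow_descending (q : ℝ) (hb : o.out b = false) {t : D.End → ℕ}
    (ht : IsTraversal o T b t) (hd : ∀ c, c ∉ T → ¬ D.FirstUnder o T b c) {h h' : D.End}
    (hlt : t h ≤ t h') : foxRow q D o T b h h' = 0 := by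
  have sng : ∀ p : D.End, t p < t h → (Pi.single p 1 : D.End → ℝ) h' = 0 := by
    intro p hp
    refine Pi.single_eq_of_ne ?_ _
    rintro rfl
    omega
  by_cases hbb : h = b
  · rw [hbb, foxRow_base]; rfl
  cases ho : o.out h with
  | false =>
    rw [foxRow_in q hbb ho]
    have hm : o.out (D.mate h) = true := by rw [o.out_mate, ho]; rfl
    have e : D.next o T (D.mate h) = h := by rw [next_of_out o T hm, D.mate_mate]
    have := ht.succ (D.mate h) (by rwa [e])
    rw [e] at this
    exact sng _ (by omega)
  | true =>
    obtain ⟨c, j⟩ := h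
    obtain ⟨i, h0, h1⟩ := o.exists_corner c
    have e0 : i + 3 + 1 = i := by rw [add_assoc]; exact add_zero i
    have e1 : i + 1 + 1 = i + 2 := by rw [add_assoc]; rfl
    have e2 : i + 1 + 2 = i + 3 := by rw [add_assoc]; rfl
    have par : ∀ p p', o.out p = false → D.partner o T p = p' → t p < t p' := by
      intro p p' hp e
      have := ht.succ p (by
        rw [next_of_in o T hp]
        intro h
        have := out_partner o T p
        rw [h, hb, hp] at this
        cases this)
      rw [next_of_in o T hp, e] at this
      omega
    have hj : j = i + 2 ∨ j = i + 3 := by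
      rcases fin_four_cases i j with rfl | rfl | rfl | rfl
      · rw [h0] at ho; cases ho
      · rw [h1] at ho; cases ho
      · exact Or.inl rfl
      · exact Or.inr rfl
    by_cases hc : c ∈ T
    · have r := foxRow_smoothed q hb h0 h1 hc
      rcases hj with rfl | rfl
      · rw [r.1]
        refine sng _ (par _ _ h1 ?_)
        simp [partner, hc, e1, h1, o.out_add_two, h0]
      · rw [r.2]
        refine sng _ (par _ _ h0 ?_)
        simp [partner, hc, h1, h0]
    · have q0 := par (c, i) (c, i + 2) h0 (by simp [partner, hc, opp])
      have q1 := par (c, i + 1) (c, i + 3) h1 (by simp [partner, hc, opp, e2])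
      by_cases hv : D.IsOver (c, i)
      · have r := foxRow_pos q hb h0 h1 hc hv
        have := ht.lt_of_descending hb (h := (c, i)) (h' := (c, i + 1)) (hd c hc) rfl hv
          (fun h => (isOver_add_one c i).1 h hv) h0 h1
        rcases hj with rfl | rfl
        · rw [r.1]
          exact sng _ q0
        · rw [r.2, Pi.add_apply, Pi.smul_apply, Pi.smul_apply, sng _ q1, sng _ (by omega)]
          simp
      · have r := foxRow_neg q hb h0 h1 hc hv
        have := ht.lt_of_descending hb (h := (c, i + 1)) (h' := (c, i)) (hd c hc) rfl
          ((isOver_add_one c i).2 hv) hv h1 h0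
        rcases hj with rfl | rfl
        · rw [r.1, Pi.add_apply, Pi.smul_apply, Pi.smul_apply, sng _ q0, sng _ (by omega)]
          simp
        · rw [r.2]
          exact sng _ q1

theorem det_eq_one_of_triangular {ι : Type*} [Fintype ι] [DecidableEq ι] {A : Matrix ι ι ℝ}
    {t : ι → ℕ} (ht : Function.Injective t) (h1 : ∀ i, A i i = 1)
    (h0 : ∀ i j, t i < t j → A i j = 0) : A.det = 1 := by
  let : LinearOrder ι := LinearOrder.lift' t ht
  have h := Matrix.det_of_isLowerTriangular A (fun i j (hij : j > i) => h0 i j hij)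
  rw [Finset.prod_congr rfl fun i _ => h1 i, Finset.prod_const_one] at h
  convert h

/-- The Fox matrix of a descending single curve has determinant one, so only the normalization at
the crossings remains. -/
theorem IsTraversal.foxDet_descending {q : ℝ} (hq : q ≠ 0) (hb : o.out b = false) {t : D.End → ℕ}
    (ht : IsTraversal o T b t) (hd : ∀ c, c ∉ T → ¬ D.FirstUnder o T b c) :
    foxDet q D o T b = q ^ (-totalOrder o T t) := by
  have hdet : (foxMatrix q D o T b).det = 1 := by
    refine det_eq_one_of_triangular ht.inj (fun h => ?_) (fun h h' hlt => ?_)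
    · simp only [foxMatrix, Pi.sub_apply, ht.foxRow_descending q hb hd le_rfl, Pi.single_eq_same,
        sub_zero]
    · simp only [foxMatrix, Pi.sub_apply, ht.foxRow_descending q hb hd hlt.le, sub_zero]
      refine Pi.single_eq_of_ne ?_ _
      rintro rfl
      omega
  rw [foxDet, hdet, mul_one, totalOrder, ← Finset.sum_neg_distrib]
  have : ∀ s : Finset D.Crossing, ∏ c ∈ s, q ^ (-crossingOrder o t c) =
      q ^ (∑ c ∈ s, -crossingOrder o t c) := by
    intro s
    induction s using Finset.induction_on with
    | empty => simp
    | insert c s hc ih => rw [Finset.prod_insert hc, Finset.sum_insert hc, zpow_add₀ hq, ih]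
  rw [← this]
  refine Finset.prod_congr rfl fun c hc => ?_
  rw [ht.sign_eq_crossingOrder hb (Finset.mem_compl.1 hc) (hd c (Finset.mem_compl.1 hc))]

end LinkDiagram

namespace LinkDiagram

/-- A diagram has this property if every flow along its arcs that is conserved at the crossings is
the coboundary of a function on the regions, as it is for a diagram in the plane.  The value at the
end `(x, e)` is the value at the region between the ends `(x, e)` and `(x, e + 1)`. -/
def HasPotentials (D : LinkDiagram) : Prop :=
  ∀ g : D.End → ℤ, (∀ h, g (D.mate h) = -g h) → (∀ x, ∑ e : Fin 4, g (x, e) = 0) →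
    ∃ φ : D.End → ℤ, (∀ x e, φ (x, e + 1) = φ (x, e) + g (x, e + 1)) ∧
      ∀ h, φ h = φ ((D.mate h).1, (D.mate h).2 + 3)

variable {D : LinkDiagram} {o : D.Orientation} {T : Finset D.Crossing} {b : D.End}

/-- The ends on the component of `b` in the diagram smoothed at `T`. -/
def onCurve (o : D.Orientation) (T : Finset D.Crossing) (b : D.End) : Set D.End :=
  {h | ∃ n, (D.next o T)^[n] b = h}

theorem next_mem_onCurve {h : D.End} : D.next o T h ∈ onCurve o T b ↔ h ∈ onCurve o T b := by
  constructor
  · rintro ⟨n, hn⟩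
    rcases n with _ | n
    · obtain ⟨m, hm, hb⟩ := Function.mem_periodicPts.1 ((next_injective o T).mem_periodicPts b)
      obtain ⟨m, rfl⟩ := Nat.exists_eq_succ_of_ne_zero hm.ne'
      refine ⟨m, next_injective o T ?_⟩
      rw [← Function.iterate_succ_apply' (D.next o T)]
      exact hb.eq.trans hn
    · rw [Function.iterate_succ_apply'] at hn
      exact ⟨n, next_injective o T hn⟩
  · rintro ⟨n, hn⟩
    exact ⟨n + 1, by rw [Function.iterate_succ_apply', hn]⟩

theorem mate_mem_onCurve {h : D.End} : D.mate h ∈ onCurve o T b ↔ h ∈ onCurve o T b := by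
  cases ho : o.out h with
  | true => rw [← next_of_out o T ho, next_mem_onCurve]
  | false =>
    have hm : o.out (D.mate h) = true := by rw [o.out_mate, ho]; rfl
    rw [← next_mem_onCurve, next_of_out o T hm, D.mate_mate]

theorem partner_mem_onCurve {h : D.End} :
    D.partner o T h ∈ onCurve o T b ↔ h ∈ onCurve o T b := by
  cases ho : o.out h with
  | false => rw [← next_of_in o T ho, next_mem_onCurve]
  | true =>
    have hm : o.out (D.partner o T h) = false := by rw [out_partner, ho]; rfl
    rw [← next_mem_onCurve, next_of_in o T hm, partner_partner]

/-- The Fox determinant of a descending diagram with several components vanishes: the component of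
the base point lies above the others, and the power of the parameter given by the winding number
around this component solves the Fox relations on the other ones. -/
theorem foxDet_descending_of_not_single (hD : D.HasPotentials) {q : ℝ} (hq : q ≠ 0)
    (hb : o.out b = false) (hd : ∀ c, c ∉ T → ¬ D.FirstUnder o T b c)
    (hs : ¬ D.IsSingleCurve o T b) : foxDet q D o T b = 0 := by
  classical
  let V := onCurve o T b
  have hbV : b ∈ V := ⟨0, rfl⟩
  let g : D.End → ℤ := fun h => if h ∈ V then o.dir h else 0
  have gV : ∀ {h}, h ∈ V → g h = o.dir h := fun h => if_pos h
  have gn : ∀ {h}, h ∉ V → g h = 0 := fun h => if_neg h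
  have gpart : ∀ h, g (D.partner o T h) = -g h := by
    intro h
    by_cases hV : h ∈ V
    · rw [gV hV, gV (partner_mem_onCurve.2 hV), dir_partner]
    · rw [gn hV, gn fun h' => hV (partner_mem_onCurve.1 h'), neg_zero]
  have gmate : ∀ h, g (D.mate h) = -g h := by
    intro h
    by_cases hV : h ∈ V
    · rw [gV hV, gV (mate_mem_onCurve.2 hV), o.dir_mate]
    · rw [gn hV, gn fun h' => hV (mate_mem_onCurve.1 h'), neg_zero]
  have gsum : ∀ x, ∑ e : Fin 4, g (x, e) = 0 := by
    intro x
    have hx : ∀ e : Fin 4, (x, (D.partner o T (x, e)).2) = D.partner o T (x, e) := fun e =>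
      Prod.ext (partner_fst o T (x, e)).symm rfl
    refine Finset.sum_involution (fun e _ => (D.partner o T (x, e)).2) ?_ ?_ ?_ ?_
    · intro e _
      rw [hx, gpart, add_neg_cancel]
    · intro e _ _ h
      exact partner_ne o T (x, e) (by rw [← hx, h])
    · intro e _
      exact Finset.mem_univ _
    · intro e _
      simp only [hx, partner_partner]
  obtain ⟨φ, hφ1, hφ2⟩ := hD g gmate gsum
  let v : D.End → ℝ := fun h => if h ∈ V then 0 else (q ^ 2) ^ φ h
  have vV : ∀ {h}, h ∈ V → v h = 0 := fun h => if_pos h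
  have vn : ∀ {h}, h ∉ V → v h = (q ^ 2) ^ φ h := fun h => if_neg h
  have vcongr : ∀ {h h'}, (h ∈ V ↔ h' ∈ V) → (h ∉ V → h' ∉ V → φ h = φ h') → v h = v h' := by
    intro h h' e1 e2
    by_cases hV : h ∈ V
    · rw [vV hV, vV (e1.1 hV)]
    · have hV' := fun h' => hV (e1.2 h')
      rw [vn hV, vn hV', e2 hV hV']
  have hq2 : q ^ 2 ≠ 0 := pow_ne_zero 2 hq
  have rows : ∀ h, foxRow q D o T b h ⬝ᵥ v = v h := by
    intro h
    by_cases hbb : h = b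
    · rw [hbb, foxRow_base, vV hbV, zero_dotProduct]
    cases ho : o.out h with
    | false =>
      rw [foxRow_in q hbb ho, single_one_dotProduct]
      refine vcongr mate_mem_onCurve fun h1 _ => ?_
      have e : (D.mate h).2 + 3 + 1 = (D.mate h).2 := by rw [add_assoc]; exact add_zero _
      have := hφ1 (D.mate h).1 ((D.mate h).2 + 3)
      rw [e, ← hφ2 h] at this
      rw [show D.mate h = ((D.mate h).1, (D.mate h).2) from rfl, this, gn h1, add_zero]
    | true =>
      obtain ⟨c, j⟩ := h
      obtain ⟨i, h0, h1⟩ := o.exists_corner c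
      have e0 : i + 3 + 1 = i := by rw [add_assoc]; exact add_zero i
      have e1 : i + 1 + 1 = i + 2 := by rw [add_assoc]; rfl
      have e2 : i + 1 + 2 = i + 3 := by rw [add_assoc]; rfl
      have e3 : i + 2 + 1 = i + 3 := by rw [add_assoc]; rfl
      have o2 : o.out (c, i + 2) = true := by rw [o.out_add_two, h0]; rfl
      have o3 : o.out (c, i + 3) = true := by rw [o.out_add_three, h1]; rfl
      have p1 := hφ1 c i
      have p2 := hφ1 c (i + 1)
      have p3 := hφ1 c (i + 2)
      have p0 := hφ1 c (i + 3)
      rw [e1] at p2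
      rw [e3] at p3
      rw [e0] at p0
      have hj : j = i + 2 ∨ j = i + 3 := by
        rcases fin_four_cases i j with rfl | rfl | rfl | rfl
        · rw [h0] at ho; cases ho
        · rw [h1] at ho; cases ho
        · exact Or.inl rfl
        · exact Or.inr rfl
      by_cases hc : c ∈ T
      · have r := foxRow_smoothed q hb h0 h1 hc
        have m1 : D.partner o T (c, i + 1) = (c, i + 2) := by
          simp [partner, hc, e1, h1, o2]
        have m0 : D.partner o T (c, i) = (c, i + 3) := by
          simp [partner, hc, h1, h0]
        rcases hj with rfl | rfl
        · rw [r.1, single_one_dotProduct]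
          refine vcongr ?_ fun _ n2 => ?_
          · rw [← m1]; exact partner_mem_onCurve.symm
          · rw [gn n2] at p2; omega
        · rw [r.2, single_one_dotProduct]
          refine vcongr ?_ fun n0 _ => ?_
          · rw [← m0]; exact partner_mem_onCurve.symm
          · rw [gn n0] at p0; omega
      · have m0 : (c, i + 2) ∈ V ↔ (c, i) ∈ V := by
          have : D.partner o T (c, i) = (c, i + 2) := by simp [partner, hc, opp]
          rw [← this]
          exact partner_mem_onCurve
        have m1 : (c, i + 3) ∈ V ↔ (c, i + 1) ∈ V := by
          have : D.partner o T (c, i + 1) = (c, i + 3) := by simp [partner, hc, opp, e2]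
          rw [← this]
          exact partner_mem_onCurve
        have g2 : (c, i) ∈ V → g (c, i + 2) = 1 := fun h => by
          rw [gV (m0.2 h)]; simp [Orientation.dir, o2]
        have g1 : (c, i + 1) ∈ V → g (c, i + 1) = -1 := fun h => by
          rw [gV h]; simp [Orientation.dir, h1]
        -- The component of the base point meets the under-strand only after the over-strand.
        have desc : ∀ {h h' : D.End}, h.1 = c → h'.1 = c → D.IsOver h → ¬ D.IsOver h' →
            o.out h = false → o.out h' = false → h' ∈ V → h ∈ V := by
          rintro h h' hc1 hc2 hv hu hi hi' ⟨n, hn⟩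
          obtain ⟨m, -, hm⟩ := exists_walk_iterate o T hb hi' hn
          obtain ⟨m', -, a1, a2, a3⟩ := exists_over_of_not_firstUnder hb (hd c hc) (n := m)
            (by rw [hm, hc2]) (by rwa [hm])
          have := eq_of_isOver_of_in (o := o) (a1.trans hc1.symm) a2 hv a3 hi
          exact ⟨2 * m', by rw [← (walk_iterate o T hb m').1, this]⟩
        by_cases hv : D.IsOver (c, i)
        · have r := foxRow_pos q hb h0 h1 hc hv
          have d := desc (h := (c, i)) (h' := (c, i + 1)) rfl rfl hv
            (fun h => (isOver_add_one c i).1 h hv) h0 h1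
          rcases hj with rfl | rfl
          · rw [r.1, single_one_dotProduct]
            refine vcongr m0.symm fun n0 n2 => ?_
            rw [gn n2] at p2
            rw [gn fun h => n0 (d h)] at p1
            omega
          · rw [r.2, add_dotProduct, smul_dotProduct, smul_dotProduct, single_one_dotProduct,
              single_one_dotProduct, smul_eq_mul, smul_eq_mul]
            by_cases hV1 : (c, i + 1) ∈ V
            · rw [vV hV1, vV (d hV1), vV (m1.2 hV1)]; ring
            · have hV3 : (c, i + 3) ∉ V := fun h => hV1 (m1.1 h)
              rw [gn hV3] at p3
              by_cases hV0 : (c, i) ∈ V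
              · rw [g2 hV0] at p2
                rw [vV hV0, vn hV1, vn hV3, p3, p2, add_zero, zpow_add_one₀ hq2]
                ring
              · rw [gn hV1] at p1
                rw [gn fun h => hV0 (m0.1 h)] at p2
                rw [vn hV1, vn hV3, vn hV0, p3, p2, p1]
                simp only [add_zero]
                ring
        · have r := foxRow_neg q hb h0 h1 hc hv
          have d := desc (h := (c, i + 1)) (h' := (c, i)) rfl rfl ((isOver_add_one c i).2 hv) hv
            h1 h0
          rcases hj with rfl | rfl
          · rw [r.1, add_dotProduct, smul_dotProduct, smul_dotProduct, single_one_dotProduct,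
              single_one_dotProduct, smul_eq_mul, smul_eq_mul]
            by_cases hV0 : (c, i) ∈ V
            · rw [vV hV0, vV (d hV0), vV (m0.2 hV0)]; ring
            · have hV2 : (c, i + 2) ∉ V := fun h => hV0 (m0.1 h)
              rw [gn hV2] at p2
              by_cases hV1 : (c, i + 1) ∈ V
              · rw [g1 hV1] at p1
                rw [vV hV1, vn hV0, vn hV2, p2, p1, add_zero, zpow_add₀ hq2, zpow_neg_one]
                ring
              · rw [gn hV1] at p1
                rw [vn hV1, vn hV2, vn hV0, p2, p1]
                simp only [add_zero]
                ring
          · rw [r.2, single_one_dotProduct]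
            refine vcongr m1.symm fun n1 n3 => ?_
            rw [gn n3] at p3
            rw [gn fun h => n1 (d (m0.1 h))] at p2
            omega
  have hv : ∃ v ≠ 0, (foxMatrix q D o T b).mulVec v = 0 := by
    rw [isSingleCurve_iff o T hb] at hs
    push Not at hs
    obtain ⟨h, hh⟩ := hs
    refine ⟨v, fun h0 => ?_, ?_⟩
    · have := congrFun h0 h
      rw [vn fun ⟨n, hn⟩ => hh n hn] at this
      exact zpow_ne_zero _ hq2 this
    · ext h
      change (Pi.single h 1 - foxRow q D o T b h) ⬝ᵥ v = 0
      rw [sub_dotProduct, rows, single_one_dotProduct, sub_self]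
  rw [foxDet, Matrix.exists_mulVec_eq_zero_iff.1 hv, mul_zero]

end LinkDiagram

namespace LinkDiagram

/-! ### The Conway polynomial as a determinant -/

theorem not_firstUnder_switch {D : LinkDiagram} {o : D.Orientation} {T : Finset D.Crossing}
    {b : D.End} {c : D.Crossing} (h : D.FirstUnder o T b c) :
    ¬ (D.switch c).FirstUnder (o.switch c) T b c := by
  rintro ⟨m, hm, hu', hm'⟩
  obtain ⟨n, hn, hu, hn'⟩ := h
  rcases lt_trichotomy m n with h | rfl | h
  · exact hn' m h hm
  · exact hu' ((D.isOver_switch_self _ hn).2 hu)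
  · exact hm' n h hn

open Classical in
/-- Up to a power of `q` the Fox determinant is the value of the Conway polynomial at `q⁻¹ - q`:
both obey the same skein relation, and they agree on descending diagrams.  The induction is on the
number `n` of crossings that are not smoothed, and on the number `m` of those among them that are
met for the first time on their under-strand. -/
theorem foxDet_eq_eval_aux {q : ℝ} (hq : q ≠ 0) {κ : ℤ} (n : ℕ) :
    ∀ (m : ℕ) (D : LinkDiagram) (o : D.Orientation) (T : Finset D.Crossing) (b : D.End),
      Tᶜ.card = n → (Tᶜ.filter fun c => D.FirstUnder o T b c).card = m →
      o.out b = false → D.HasPotentials →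
      (∀ T t, IsTraversal o T b t → totalOrder o T t = κ) →
      foxDet q D o T b =
        q ^ (-κ) * (D.conwaySmoothed o T b).eval₂ (Int.castRingHom ℝ) (q⁻¹ - q) := by
  induction n using Nat.strong_induction_on with
  | _ n ihn =>
  intro m
  induction m with
  | zero =>
    intro D o T b _ hm hb hD hκ
    have hd : ∀ c, c ∉ T → ¬ D.FirstUnder o T b c := by
      intro c hc hf
      rw [Finset.card_eq_zero] at hm
      exact Finset.notMem_empty c (hm ▸ Finset.mem_filter.2 ⟨Finset.mem_compl.2 hc, hf⟩)
    rw [D.conwaySmoothed_of_descending o T b hd]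
    by_cases hs : D.IsSingleCurve o T b
    · obtain ⟨t, ht⟩ := exists_isTraversal o T ((isSingleCurve_iff o T hb).1 hs)
      rw [ht.foxDet_descending hq hb hd, hκ T t ht, if_pos hs, Polynomial.eval₂_one, mul_one]
    · rw [foxDet_descending_of_not_single hD hq hb hd hs, if_neg hs, Polynomial.eval₂_zero,
        mul_zero]
  | succ m ihm =>
    intro D o T b hn hm hb hD hκ
    obtain ⟨c, hcm⟩ := Finset.card_pos.1 (by rw [hm]; exact Nat.succ_pos m)
    obtain ⟨hcT, hcf⟩ := Finset.mem_filter.1 hcm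
    have hc := Finset.mem_compl.1 hcT
    let F' : D.Crossing → Prop := fun x => (D.switch c).FirstUnder (o.switch c) T b x
    have hF' : ∀ x, x ≠ c → (F' x ↔ D.FirstUnder o T b x) := fun x hx =>
      D.firstUnder_switch_of_ne o T b hx
    have hF'c : ¬ F' c := not_firstUnder_switch hcf
    have hsw : (Tᶜ.filter F').card = m := by
      have : Tᶜ.filter F' = (Tᶜ.filter fun x => D.FirstUnder o T b x).erase c := by
        ext x
        rw [Finset.mem_erase, Finset.mem_filter, Finset.mem_filter]
        by_cases hx : x = c
        · subst hx
          simp [hF'c]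
        · simp [hx, hF' x hx]
      rw [this, Finset.card_erase_of_mem hcm, hm, Nat.add_sub_cancel]
    have h1 := ihm (D.switch c) (o.switch c) T b hn hsw hb hD
      (fun T t ht => hκ T t ⟨ht.inj, ht.zero, ht.succ, ht.last, ht.le, ht.reach⟩)
    have hcard : (insert c T)ᶜ.card < n := by
      rw [← hn]
      refine Finset.card_lt_card ⟨Finset.compl_subset_compl.2 (Finset.subset_insert c T),
        fun h => ?_⟩
      exact Finset.mem_compl.1 (h hcT) (Finset.mem_insert_self c T)
    have h2 := ihn _ hcard _ D o (insert c T) b rfl rfl hb hD hκ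
    have h3 := foxDet_skein hq (T := T) hb hc
    have h4 := congrArg (Polynomial.eval₂ (Int.castRingHom ℝ) (q⁻¹ - q))
      (D.conwaySmoothed_skein o T b c hc)
    rw [Polynomial.eval₂_sub, Polynomial.eval₂_mul, Polynomial.eval₂_mul, Polynomial.eval₂_C,
      Polynomial.eval₂_X, eq_intCast] at h4
    rw [h1, h2] at h3
    linear_combination h3 - q ^ (-κ) * h4

theorem foxDet_eq_eval {q : ℝ} (hq : q ≠ 0) {κ : ℤ} {D : LinkDiagram} {o : D.Orientation}
    {b : D.End} (hb : o.out b = false) (hD : D.HasPotentials)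
    (hκ : ∀ T t, IsTraversal o T b t → totalOrder o T t = κ) :
    foxDet q D o ∅ b =
      q ^ (-κ) * (D.conway o b).eval₂ (Int.castRingHom ℝ) (q⁻¹ - q) :=
  foxDet_eq_eval_aux hq _ _ D o ∅ b rfl rfl hb hD hκ

/-- A colouring of the arcs of a diagram by real numbers, given on the ends, that satisfies the Fox
relations at all crossings.  In contrast to the Fox matrix no value is prescribed at a base
point. -/
structure IsFoxColoring (q : ℝ) {D : LinkDiagram} (o : D.Orientation) (v : D.End → ℝ) : Prop where
  mate_eq : ∀ h, v (D.mate h) = v h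
  over_eq : ∀ h, D.IsOver h → v (D.opp h) = v h
  under_eq : ∀ h, o.out h = true → ¬ D.IsOver h →
    v h = (q ^ 2) ^ D.sign o h.1 * v (D.opp h) + (1 - (q ^ 2) ^ D.sign o h.1) * v (inNbr o h)

/-- A colouring that is not constant forces the Fox determinant to vanish. -/
theorem IsFoxColoring.foxDet_eq_zero {q : ℝ} {D : LinkDiagram} {o : D.Orientation}
    {v : D.End → ℝ} (hv : IsFoxColoring q o v) {h₁ h₂ : D.End} (hne : v h₁ ≠ v h₂) (b : D.End) :
    foxDet q D o ∅ b = 0 := by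
  have hker : ∃ w ≠ 0, (foxMatrix q D o ∅ b).mulVec w = 0 := by
    refine ⟨fun h => v h - v b, fun h0 => hne ?_, ?_⟩
    · have e1 := congrFun h0 h₁
      have e2 := congrFun h0 h₂
      simp only [Pi.zero_apply] at e1 e2
      linarith
    · ext h
      change (Pi.single h 1 - foxRow q D o ∅ b h) ⬝ᵥ (fun h => v h - v b) = 0
      rw [sub_dotProduct, single_one_dotProduct]
      unfold foxRow
      split_ifs with h1 h2 h3 h4
      · rw [h1, zero_dotProduct, sub_self, sub_zero]
      · exact absurd h3 (Finset.notMem_empty _)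
      · rw [single_one_dotProduct, hv.over_eq h h4, sub_self]
      · rw [add_dotProduct, smul_dotProduct, smul_dotProduct, single_one_dotProduct,
          single_one_dotProduct, smul_eq_mul, smul_eq_mul, hv.under_eq h h2 h4]
        ring
      · rw [single_one_dotProduct, hv.mate_eq, sub_self]
  rw [foxDet, Matrix.exists_mulVec_eq_zero_iff.1 hker, mul_zero]

end LinkDiagram

open LinkDiagram in
/-- If for infinitely many parameters a pretzel diagram has a colouring that is not constant, then
its Conway polynomial vanishes. -/
theorem conway_pretzel_eq_zero_of_coloring {u : ℕ} (hu : 2 ≤ u) (k : Fin u → ℤ) (hk : ∀ i, k i ≠ 0)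
    (o : (pretzel k hk).Orientation) {b : (pretzel k hk).End} (hb : o.out b = false)
    {Q : Set ℝ} (hQ : Q.Infinite) (hQ1 : ∀ q ∈ Q, 1 < q)
    (hcol : ∀ q ∈ Q, ∃ v : (pretzel k hk).End → ℝ, IsFoxColoring q o v ∧ ∃ h₁ h₂, v h₁ ≠ v h₂) :
    (pretzel k hk).conway o b = 0 := by
  have hpot : (pretzel k hk).HasPotentials := fun g hg hx =>
    exists_pretzel_potential hk (g := g) hg hx
  obtain ⟨κ, hκ⟩ : ∃ κ : ℤ, ∀ T t, IsTraversal o T b t → totalOrder o T t = κ := by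
    by_cases h : ∃ T t, IsTraversal o T b t
    · obtain ⟨T, t, ht⟩ := h
      exact ⟨_, fun T' t' ht' => totalOrder_pretzel hu k hk o hb ht' ht⟩
    · exact ⟨0, fun T t ht => absurd ⟨T, t, ht⟩ h⟩
  have hroot : ∀ q ∈ Q,
      (((pretzel k hk).conway o b).map (Int.castRingHom ℝ)).IsRoot (q⁻¹ - q) := by
    intro q hq
    have hq0 : q ≠ 0 := (zero_lt_one.trans (hQ1 q hq)).ne'
    obtain ⟨v, hv, h₁, h₂, hne⟩ := hcol q hq
    have h := foxDet_eq_eval hq0 hb hpot hκ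
    rw [hv.foxDet_eq_zero hne b] at h
    rw [Polynomial.IsRoot, Polynomial.eval_map]
    exact (mul_eq_zero.1 h.symm).resolve_left (zpow_ne_zero _ hq0)
  have hinj : Set.InjOn (fun q : ℝ => q⁻¹ - q) Q := by
    have : ∀ p ∈ Q, ∀ q ∈ Q, p < q → q⁻¹ - q < p⁻¹ - p := by
      intro p hp q _ hlt
      have := inv_strictAnti₀ (zero_lt_one.trans (hQ1 p hp)) hlt
      linarith
    intro p hp q hq e
    rcases lt_trichotomy p q with h | h | h
    · exact absurd e (this p hp q hq h).ne'
    · exact h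
    · exact absurd e (this q hq p hp h).ne
  refine (Polynomial.map_eq_zero_iff (Int.castRingHom ℝ).injective_int).1
    (Polynomial.eq_zero_of_infinite_isRoot _ ((hQ.image hinj).mono ?_))
  rintro _ ⟨q, hq, rfl⟩
  exact hroot q hq

/-! ### Cyclic sequences -/

/-- Factors with product one, indexed cyclically, are the quotients of the successive terms of a
cyclic sequence. -/
@[to_additive]
theorem exists_prod_rotate_primitive {M : Type*} [CommMonoid M] {u : ℕ} (r : Fin u → M)
    (hr : ∏ i, r i = 1) : ∃ g : Fin u → M, (∀ i, g (finRotate u i) = g i * r i) ∧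
      ∀ i : Fin u, i.val = 0 → g i = 1 := by
  let r' : ℕ → M := fun j => if h : j < u then r ⟨j, h⟩ else 1
  have hr' : ∀ i : Fin u, r' i = r i := fun i => dif_pos i.2
  refine ⟨fun i => ∏ j ∈ Finset.range i, r' j, fun i => ?_, fun i hi => by simp [hi]⟩
  obtain ⟨n, rfl⟩ := Nat.exists_eq_succ_of_ne_zero (Nat.pos_iff_ne_zero.1 i.pos)
  simp only
  rw [← hr', ← Finset.prod_range_succ]
  by_cases hi : i = Fin.last n
  · subst hi
    rw [finRotate_last, Fin.val_zero, Finset.prod_range_zero, Fin.val_last,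
      Finset.prod_range, ← hr]
    exact Finset.prod_congr rfl fun i _ => (hr' i).symm
  · rw [coe_finRotate_of_ne_last hi]

theorem finRotate_induction {u : ℕ} {p : Fin u → Prop} {i : Fin u} (hi : p i)
    (h : ∀ i, p i → p (finRotate u i)) (j : Fin u) : p j := by
  obtain ⟨n, rfl⟩ := Nat.exists_eq_succ_of_ne_zero (Nat.pos_iff_ne_zero.1 i.pos)
  have key : ∀ m : ℕ, p (i + Fin.ofNat (n + 1) m) := by
    intro m
    induction m with
    | zero => simpa using hi
    | succ m ih =>
      have := h _ ih
      rw [finRotate_apply, add_assoc] at this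
      have e : Fin.ofNat (n + 1) m + 1 = Fin.ofNat (n + 1) (m + 1) := by
        ext
        simp [Fin.val_add]
      rwa [e] at this
  have := key (j - i).val
  rwa [Fin.ofNat_val_eq_self, add_sub_cancel] at this

/-! ### Erasable sequences -/

theorem Erasable.perm_map_neg {l : List ℤ} (hl : Erasable l) : (l.map Neg.neg).Perm l := by
  induction hl with
  | pair a b h =>
    have hb : b = -a := by linarith
    subst hb
    simpa using List.Perm.swap _ _ _
  | step l i j hij hj h hl ih =>
    have e1 : l.Perm (l[j] :: l.eraseIdx j) := (List.getElem_cons_eraseIdx_perm hj).symm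
    have hi : i < (l.eraseIdx j).length := by
      rw [List.length_eraseIdx_of_lt hj]; omega
    have e2 := (List.getElem_cons_eraseIdx_perm hi).symm
    rw [List.getElem_eraseIdx_of_lt _ hij] at e2
    have e3 := e1.trans (e2.cons l[j])
    have hi' : l[i] = -l[j] := by linarith
    rw [hi'] at e3
    refine (e3.map Neg.neg).trans (List.Perm.trans ?_ e3.symm)
    simp only [List.map_cons, neg_neg]
    exact (List.Perm.swap _ _ _).trans ((ih.cons _).cons _)

theorem Erasable.length {l : List ℤ} (hl : Erasable l) : 2 ≤ l.length ∧ Even l.length := by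
  induction hl with
  | pair a b h => simp
  | step l i j hij hj h hl ih =>
    have hi : i < (l.eraseIdx j).length := by
      rw [List.length_eraseIdx_of_lt hj]; omega
    rw [List.length_eraseIdx_of_lt hi, List.length_eraseIdx_of_lt hj] at ih
    refine ⟨by omega, ?_⟩
    have e : l.length = l.length - 1 - 1 + 2 := by omega
    rw [e]
    exact ih.2.add even_two

@[to_additive]
theorem Erasable.prod_neg {M : Type*} [CommMonoid M] {u : ℕ} {k : Fin u → ℤ}
    (hk : Erasable (List.ofFn k)) (F : ℤ → M) : ∏ i, F (-k i) = ∏ i, F (k i) := by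
  have h := (hk.perm_map_neg.map F).prod_eq
  rw [List.map_map, List.map_ofFn, List.map_ofFn, List.prod_ofFn, List.prod_ofFn] at h
  exact h

theorem Erasable.sum_odd {u : ℕ} {k : Fin u → ℤ} (hk : Erasable (List.ofFn k)) {F : ℤ → ℝ}
    (hF : ∀ i, F (-k i) = -F (k i)) : ∑ i, F (k i) = 0 := by
  have h := hk.sum_neg F
  rw [Finset.sum_congr rfl fun i _ => hF i, Finset.sum_neg_distrib] at h
  linarith

/-! ### Components of pretzel links -/

/-- A pretzel link has at least as many components as there are columns with an even number of
half-twists: the right strands of these columns lie on different components. -/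
theorem card_even_le_numComponents {u : ℕ} (k : Fin u → ℤ) (hk : ∀ i, k i ≠ 0)
    (hfin : (pretzel k hk).numComponents ≠ 0) :
    (Finset.univ.filter fun i => Even (k i)).card ≤ (pretzel k hk).numComponents := by
  classical
  set e := (Finset.univ.filter fun i => Even (k i)).card with he
  rcases Nat.eq_zero_or_pos e with h0 | hpos
  · omega
  have : NeZero e := ⟨hpos.ne'⟩
  -- The label of the gap to the left of a column counts the even columns before it, modulo `e`.
  obtain ⟨L, hL, -⟩ := exists_sum_rotate_primitive
    (fun i => if Even (k i) then (1 : ZMod e) else 0) (by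
      rw [Finset.sum_boole, ← he, ZMod.natCast_self])
  let lab : PretzelCrossing k × Fin 4 → ZMod e := fun h =>
    L h.1.1 + if Even (k h.1.1) ∧ Even (h.1.2.val + h.2.val) then 1 else 0
  have natAbs_even : ∀ i, Even (k i) → (k i).natAbs % 2 = 0 := fun i h =>
    Nat.even_iff.1 (Int.natAbs_even.2 h)
  have lab_mate : ∀ h, lab (pretzelMate k hk h) = lab h := by
    refine pretzelMate_induction k hk (P := fun h h' => lab h' = lab h)
      (fun h h' e => e.symm) ?_ ?_ ?_ ?_
    · intro i
      simp [-finRotate_apply, lab, pretzelTop, hL]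
    · intro i
      have n1 := Int.natAbs_pos.2 (hk i)
      have n2 := Int.natAbs_pos.2 (hk (finRotate u i))
      have c1 : ¬ (Even (k (finRotate u i)) ∧
          Even ((pretzelBot k hk (finRotate u i)).2.val + (2 : Fin 4).val)) := by
        rintro ⟨h1, h2⟩
        have := natAbs_even _ h1
        rw [Nat.even_iff] at h2
        change ((k (finRotate u i)).natAbs - 1 + 2) % 2 = 0 at h2
        omega
      have c2 : (Even (k i) ∧ Even ((pretzelBot k hk i).2.val + (3 : Fin 4).val)) ↔
          Even (k i) := by
        refine and_iff_left_of_imp fun h1 => ?_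
        have := natAbs_even _ h1
        rw [Nat.even_iff]
        change ((k i).natAbs - 1 + 3) % 2 = 0
        omega
      change L (finRotate u i) + (if Even (k (finRotate u i)) ∧
        Even ((pretzelBot k hk (finRotate u i)).2.val + (2 : Fin 4).val) then 1 else 0) =
        L i + if Even (k i) ∧ Even ((pretzelBot k hk i).2.val + (3 : Fin 4).val) then 1 else 0
      rw [if_neg c1, if_congr c2 rfl rfl, hL, add_zero]
    · intro i j h
      rfl
    · intro i j h
      have : Even (j + 1 + (0 : Fin 4).val) ↔ Even (j + (3 : Fin 4).val) := by
        rw [Nat.even_iff, Nat.even_iff]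
        change (j + 1 + 0) % 2 = 0 ↔ (j + 3) % 2 = 0
        omega
      change L i + (if Even (k i) ∧ Even (j + 1 + (0 : Fin 4).val) then 1 else 0) =
        L i + if Even (k i) ∧ Even (j + (3 : Fin 4).val) then 1 else 0
      simp only [this]
  have lab_opp : ∀ h, lab (h.1, h.2 + 2) = lab h := by
    rintro ⟨⟨i, j⟩, d⟩
    have : Even (j.val + (d + 2).val) ↔ Even (j.val + d.val) := by
      rw [Nat.even_iff, Nat.even_iff]
      fin_cases d
      · change (j.val + 2) % 2 = 0 ↔ (j.val + 0) % 2 = 0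
        omega
      · change (j.val + 3) % 2 = 0 ↔ (j.val + 1) % 2 = 0
        omega
      · change (j.val + 0) % 2 = 0 ↔ (j.val + 2) % 2 = 0
        omega
      · change (j.val + 1) % 2 = 0 ↔ (j.val + 3) % 2 = 0
        omega
    simp only [lab, this]
  let f : (pretzel k hk).Component → ZMod e := Quot.lift lab (by
    rintro h h' (rfl | rfl)
    · exact (lab_mate h).symm
    · exact (lab_opp h).symm)
  obtain ⟨i₀, hi₀⟩ := Finset.card_pos.1 hpos
  have hi₀' : Even (k i₀) := (Finset.mem_filter.1 hi₀).2
  have step : ∀ i, ∃ i', L i' = L i + 1 := by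
    intro i
    by_contra hne
    push Not at hne
    have const : ∀ i', L i' = L i → L (finRotate u i') = L i := by
      intro i' h
      by_cases hi' : Even (k i')
      · exact absurd (by rw [hL, if_pos hi', h]) (hne (finRotate u i'))
      · rw [hL, if_neg hi', h, add_zero]
    have all := finRotate_induction (p := fun i' => L i' = L i) rfl const
    have h0 := hL i₀
    rw [if_pos hi₀', all i₀] at h0
    exact hne _ h0
  have surjL : ∀ z : ZMod e, ∃ i, L i = z := by
    intro z
    have : ∀ n : ℕ, ∃ i, L i = L i₀ + n := by
      intro n
      induction n with
      | zero => exact ⟨i₀, by simp⟩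
      | succ n ih =>
        obtain ⟨i, hi⟩ := ih
        obtain ⟨i', hi'⟩ := step i
        exact ⟨i', by rw [hi', hi]; push_cast; ring⟩
    obtain ⟨i, hi⟩ := this (z - L i₀).val
    exact ⟨i, by rw [hi, ZMod.natCast_zmod_val]; ring⟩
  have surj : Function.Surjective f := by
    intro z
    obtain ⟨i, hi⟩ := surjL z
    refine ⟨Quot.mk _ (pretzelTop k hk i, 1), ?_⟩
    change L i + (if Even (k i) ∧ Even (0 + (1 : Fin 4).val) then 1 else 0) = z
    rw [if_neg (by rintro ⟨-, h⟩; exact absurd h (by decide)), add_zero, hi]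
  have : Finite (pretzel k hk).Component := Nat.finite_of_card_ne_zero hfin
  have := Nat.card_le_card_of_surjective f surj
  rwa [Nat.card_zmod] at this

namespace LinkDiagram

/-! ### Colourings, crossing by crossing -/

theorem sign_eq_dir {D : LinkDiagram} (o : D.Orientation) (c : D.Crossing) :
    D.sign o c = o.dir (c, 0) * o.dir (c, 1) * if D.evenOver c = true then 1 else -1 := by
  have h2 : o.out (c, 2) = !(o.out (c, 0)) := o.out_opp (c, 0)
  have h3 : o.out (c, 3) = !(o.out (c, 1)) := o.out_opp (c, 1)
  have v0 : D.IsOver (c, 0) ↔ D.evenOver c = true := by simp [IsOver]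
  have v1 : D.IsOver (c, 1) ↔ ¬ D.evenOver c = true := by simp [IsOver]
  have v2 : D.IsOver (c, 2) ↔ D.evenOver c = true := by simp [IsOver]
  have v3 : D.IsOver (c, 3) ↔ ¬ D.evenOver c = true := by simp [IsOver]
  have ex : ∀ p : Fin 4 → Prop, (∃ i, p i) ↔ p 0 ∨ p 1 ∨ p 2 ∨ p 3 := by
    intro p
    constructor
    · rintro ⟨i, hi⟩
      fin_cases i <;> tauto
    · rintro (h | h | h | h) <;> exact ⟨_, h⟩
  have a1 : (0 : Fin 4) + 1 = 1 := rfl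
  have a2 : (1 : Fin 4) + 1 = 2 := rfl
  have a3 : (2 : Fin 4) + 1 = 3 := rfl
  have a4 : (3 : Fin 4) + 1 = 0 := rfl
  unfold sign Orientation.dir
  simp only [ex, v0, v1, v2, v3, a1, a2, a3, a4, h2, h3]
  cases D.evenOver c <;> cases o.out (c, 0) <;> cases o.out (c, 1) <;> simp

/-- The relation at a crossing under which a function on the ends is a colouring, solved for the
ends `2` and `3`. -/
def CrossingRel (q : ℝ) {D : LinkDiagram} (o : D.Orientation) (v : D.End → ℝ) (c : D.Crossing) :
    Prop :=
  if D.evenOver c = true then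
    v (c, 2) = v (c, 0) ∧ v (c, 3) = (q ^ 2) ^ (-o.dir (c, 0)) * v (c, 1) +
      (1 - (q ^ 2) ^ (-o.dir (c, 0))) * v (c, 0)
  else
    v (c, 3) = v (c, 1) ∧ v (c, 2) = (q ^ 2) ^ o.dir (c, 1) * v (c, 0) +
      (1 - (q ^ 2) ^ o.dir (c, 1)) * v (c, 1)

theorem isFoxColoring_of_crossingRel {q : ℝ} (hq : q ≠ 0) {D : LinkDiagram} {o : D.Orientation}
    {v : D.End → ℝ} (hm : ∀ h, v (D.mate h) = v h) (hc : ∀ c, CrossingRel q o v c) :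
    IsFoxColoring q o v := by
  have hq2 : q ^ 2 ≠ 0 := pow_ne_zero 2 hq
  have h2 : ∀ c, o.out (c, 2) = !(o.out (c, 0)) := fun c => o.out_opp (c, 0)
  have h3 : ∀ c, o.out (c, 3) = !(o.out (c, 1)) := fun c => o.out_opp (c, 1)
  have v0 : ∀ c, D.IsOver (c, 0) ↔ D.evenOver c = true := fun c => by simp [IsOver]
  have v1 : ∀ c, D.IsOver (c, 1) ↔ ¬ D.evenOver c = true := fun c => by simp [IsOver]
  have v2 : ∀ c, D.IsOver (c, 2) ↔ D.evenOver c = true := fun c => by simp [IsOver]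
  have v3 : ∀ c, D.IsOver (c, 3) ↔ ¬ D.evenOver c = true := fun c => by simp [IsOver]
  refine ⟨hm, ?_, ?_⟩
  · rintro ⟨c, i⟩ ho
    have h := hc c
    unfold CrossingRel at h
    fin_cases i
    · change v (c, 2) = v (c, 0)
      rw [if_pos ((v0 c).1 ho)] at h
      exact h.1
    · change v (c, 3) = v (c, 1)
      rw [if_neg ((v1 c).1 ho)] at h
      exact h.1
    · change v (c, 0) = v (c, 2)
      rw [if_pos ((v2 c).1 ho)] at h
      exact h.1.symm
    · change v (c, 1) = v (c, 3)
      rw [if_neg ((v3 c).1 ho)] at h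
      exact h.1.symm
  · rintro ⟨c, i⟩ hi ho
    have h := hc c
    have hs := sign_eq_dir o c
    have nbr : ∀ (j j₁ j₃ : Fin 4), j + 1 = j₁ → j + 3 = j₃ → v (c, j₁) = v (c, j₃) →
        v (inNbr o (c, j)) = v (c, j₁) := by
      rintro j _ _ rfl rfl e
      unfold inNbr
      split_ifs
      · exact e.symm
      · rfl
    have d0 : o.out (c, 0) = true → o.dir (c, 0) = 1 := fun h => by simp [Orientation.dir, h]
    have d1 : o.out (c, 1) = true → o.dir (c, 1) = 1 := fun h => by simp [Orientation.dir, h]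
    have d2 : o.out (c, 2) = true → o.dir (c, 0) = -1 := fun h => by
      rw [h2] at h
      simp only [Bool.not_eq_true'] at h
      simp [Orientation.dir, h]
    have d3 : o.out (c, 3) = true → o.dir (c, 1) = -1 := fun h => by
      rw [h3] at h
      simp only [Bool.not_eq_true'] at h
      simp [Orientation.dir, h]
    unfold CrossingRel at h
    fin_cases i
    · rw [if_neg (mt (v0 c).2 ho)] at h hs
      have hn := nbr 0 1 3 rfl rfl h.1.symm
      rw [d0 hi, one_mul, mul_neg_one] at hs
      change v (c, 0) = (q ^ 2) ^ D.sign o c * v (c, 2) +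
        (1 - (q ^ 2) ^ D.sign o c) * v (inNbr o (c, 0))
      rw [hn, h.2, hs, zpow_neg]
      have := zpow_ne_zero (o.dir (c, 1)) hq2
      field_simp
      ring
    · rw [if_pos (not_not.1 (mt (v1 c).2 ho))] at h hs
      have hn := nbr 1 2 0 rfl rfl h.1
      rw [d1 hi, mul_one, mul_one] at hs
      change v (c, 1) = (q ^ 2) ^ D.sign o c * v (c, 3) +
        (1 - (q ^ 2) ^ D.sign o c) * v (inNbr o (c, 1))
      rw [hn, h.2, hs, h.1, zpow_neg]
      have := zpow_ne_zero (o.dir (c, 0)) hq2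
      field_simp
      ring
    · rw [if_neg (mt (v2 c).2 ho)] at h hs
      have hn := nbr 2 3 1 rfl rfl h.1
      rw [d2 hi, neg_one_mul, mul_neg_one, neg_neg] at hs
      change v (c, 2) = (q ^ 2) ^ D.sign o c * v (c, 0) +
        (1 - (q ^ 2) ^ D.sign o c) * v (inNbr o (c, 2))
      rw [hn, h.2, hs, h.1]
    · rw [if_pos (not_not.1 (mt (v3 c).2 ho))] at h hs
      have hn := nbr 3 0 2 rfl rfl h.1.symm
      rw [d3 hi, mul_neg_one, mul_one] at hs
      change v (c, 3) = (q ^ 2) ^ D.sign o c * v (c, 1) +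
        (1 - (q ^ 2) ^ D.sign o c) * v (inNbr o (c, 3))
      rw [hn, h.2, hs]

end LinkDiagram

/-! ### Directions along the columns of a pretzel diagram -/

section PretzelDirections

variable {u : ℕ} {k : Fin u → ℤ} {hk : ∀ i, k i ≠ 0} {f : PretzelCrossing k × Fin 4 → ℤ}

/-- In a column the directions of the left and the right upper ends are exchanged at each step. -/
theorem pretzel_dir_column (hm : ∀ h, f (pretzelMate k hk h) = -f h)
    (ho : ∀ x e, f (x, e + 2) = -f (x, e)) (i : Fin u) (j : ℕ) (hj : j < (k i).natAbs) :
    f (⟨i, ⟨j, hj⟩⟩, 1) =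
        (if Even j then f (pretzelTop k hk i, 1) else f (pretzelTop k hk i, 0)) ∧
      f (⟨i, ⟨j, hj⟩⟩, 0) =
        if Even j then f (pretzelTop k hk i, 0) else f (pretzelTop k hk i, 1) := by
  induction j with
  | zero => exact ⟨rfl, rfl⟩
  | succ j ih =>
    obtain ⟨h1, h0⟩ := ih (by omega)
    rw [← pretzelMate_two k hk i hj, ← pretzelMate_three k hk i hj, hm, hm]
    have e2 := ho ⟨i, ⟨j, by omega⟩⟩ 0
    have e3 := ho ⟨i, ⟨j, by omega⟩⟩ 1
    change f (_, 2) = _ at e2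
    change f (_, 3) = _ at e3
    rw [e2, e3, neg_neg, neg_neg, h1, h0]
    by_cases hj' : Even j <;> simp [hj', Nat.even_add_one]

theorem pretzel_dir_top (hm : ∀ h, f (pretzelMate k hk h) = -f h) (i : Fin u) :
    f (pretzelTop k hk (finRotate u i), 1) = -f (pretzelTop k hk i, 0) := by
  rw [← pretzelMate_top, hm]

/-- Whether the strands of the columns with an odd number of half-twists are parallel is the same
for all columns, and they are parallel if there is a column with an even number of half-twists:
the product of the directions of the left upper end of the top and of the right upper end of the
bottom crossing does not depend on the column. -/
theorem pretzel_dir_mul_rotate (hm : ∀ h, f (pretzelMate k hk h) = -f h)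
    (ho : ∀ x e, f (x, e + 2) = -f (x, e)) (hf : ∀ h, f h * f h = 1) (i : Fin u) :
    (if Even (k (finRotate u i)) then 1 else
      f (pretzelTop k hk (finRotate u i), 1) * f (pretzelTop k hk (finRotate u i), 0)) =
    if Even (k i) then 1 else f (pretzelTop k hk i, 1) * f (pretzelTop k hk i, 0) := by
  have hbot : ∀ i, (f (pretzelBot k hk i, 1) = if Even (k i) then f (pretzelTop k hk i, 0) else
      f (pretzelTop k hk i, 1)) ∧ (f (pretzelBot k hk i, 0) = if Even (k i) then
      f (pretzelTop k hk i, 1) else f (pretzelTop k hk i, 0)) := by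
    intro i
    have h := pretzel_dir_column hm ho i _ (pretzelBot k hk i).2.isLt
    have hp : Even ((k i).natAbs - 1) ↔ ¬ Even (k i) := by
      have := Int.natAbs_pos.2 (hk i)
      rw [← Int.natAbs_even, Nat.even_iff, Nat.even_iff]
      omega
    change (f (pretzelBot k hk i, 1) = if Even ((k i).natAbs - 1) then _ else _) ∧
      (f (pretzelBot k hk i, 0) = if Even ((k i).natAbs - 1) then _ else _) at h
    rw [h.1, h.2]
    by_cases he : Even (k i) <;> simp [hp, he]
  have hE : ∀ i, (if Even (k i) then 1 else f (pretzelTop k hk i, 1) * f (pretzelTop k hk i, 0)) =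
      f (pretzelTop k hk i, 1) * f (pretzelBot k hk i, 0) := by
    intro i
    rw [(hbot i).2]
    split_ifs
    · exact (hf _).symm
    · rfl
  have hb : f (pretzelBot k hk (finRotate u i), 0) = -f (pretzelBot k hk i, 1) := by
    have e2 := ho (pretzelBot k hk (finRotate u i)) 0
    have e3 := ho (pretzelBot k hk i) 1
    change f (_, 2) = _ at e2
    change f (_, 3) = _ at e3
    rw [← pretzelMate_bot, hm, e3] at e2
    linarith
  rw [hE, hb, pretzel_dir_top hm, (hbot i).1]
  split_ifs
  · rw [neg_mul_neg, hf]
  · ring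

end PretzelDirections

/-! ### Colourings of pretzel diagrams -/

/-- The functions `X`, `Y` colour the left and the right upper ends of the crossings of a twisted
column, whose top crossing has upper ends with directions `A` (left) and `B` (right).  The column
is continued downwards indefinitely, with right-handed half-twists for the non-negative arguments
and with left-handed ones for the non-positive arguments. -/
structure IsColumnColoring (t : ℝ) (A B : ℤ) (X Y : ℤ → ℝ) : Prop where
  left_pos : ∀ j : ℕ, X (j + 1) = Y j
  right_pos : ∀ j : ℕ, Y (j + 1) = t ^ (-if Even j then B else A) * X j +
    (1 - t ^ (-if Even j then B else A)) * Y j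
  right_neg : ∀ j : ℕ, Y (-(j + 1)) = X (-j)
  left_neg : ∀ j : ℕ, X (-(j + 1)) = t ^ (if Even j then A else B) * Y (-j) +
    (1 - t ^ (if Even j then A else B)) * X (-j)

/-- If the strands of a column are parallel, the difference of the two colours is multiplied by
`-t ^ (-A)` at each half-twist. -/
theorem isColumnColoring_parallel {t : ℝ} (ht : 0 < t) (A : ℤ) (x d : ℝ) :
    IsColumnColoring t A A (fun n => x + (1 - (-t ^ (-A)) ^ n) / (1 + t ^ (-A)) * d)
      (fun n => x + (1 - (-t ^ (-A)) ^ n) / (1 + t ^ (-A)) * d + (-t ^ (-A)) ^ n * d) := by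
  have hA : t ^ A = (t ^ (-A))⁻¹ := by rw [zpow_neg, inv_inv]
  have hs : 0 < t ^ (-A) := zpow_pos ht _
  have hs1 : 1 + t ^ (-A) ≠ 0 := by positivity
  constructor <;> intro j <;> (try simp only [ite_self, hA]) <;> generalize t ^ (-A) = s at *
  · rw [zpow_add_one₀ (neg_ne_zero.2 hs.ne')]
    field_simp
    ring
  · rw [zpow_add_one₀ (neg_ne_zero.2 hs.ne')]
    field_simp
    ring
  · rw [neg_add, ← sub_eq_add_neg, zpow_sub_one₀ (neg_ne_zero.2 hs.ne')]
    field_simp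
    ring
  · rw [neg_add, ← sub_eq_add_neg, zpow_sub_one₀ (neg_ne_zero.2 hs.ne')]
    field_simp
    ring

/-- If the strands of a column are antiparallel, the difference of the two colours alternates
between two values. -/
theorem isColumnColoring_antiparallel {t : ℝ} (ht : 0 < t) (A : ℤ) (x d : ℝ) :
    IsColumnColoring t A (-A)
      (fun n => x + (if Even n then n * (1 - t ^ A) / 2 else ((n + 1) - (n - 1) * t ^ A) / 2) * d)
      (fun n => x + (if Even n then n * (1 - t ^ A) / 2 else ((n + 1) - (n - 1) * t ^ A) / 2) * d +
        (if Even n then 1 else -t ^ A) * d) := by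
  have ha : t ^ A ≠ 0 := (zpow_pos ht _).ne'
  constructor <;> intro j <;>
    simp only [Int.even_add_one, even_neg, Int.even_coe_nat] <;>
    by_cases hj : Even j <;> simp only [hj, if_true, if_false, not_true, not_false_iff,
      neg_neg, zpow_neg] <;> push_cast <;> field_simp <;> ring

section PretzelColorings

open LinkDiagram

variable {u : ℕ} {k : Fin u → ℤ} {hk : ∀ i, k i ≠ 0}

/-- Colourings of the columns that agree along the bridges form a colouring of the pretzel
diagram. -/
theorem exists_isFoxColoring_pretzel (o : (pretzel k hk).Orientation) {q : ℝ} (hq : q ≠ 0)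
    {X Y : Fin u → ℤ → ℝ}
    (hXY : ∀ i, IsColumnColoring (q ^ 2) (o.dir (pretzelTop k hk i, 1))
      (o.dir (pretzelTop k hk i, 0)) (X i) (Y i))
    (htop : ∀ i, X (finRotate u i) 0 = Y i 0)
    (hbot : ∀ i, X (finRotate u i) (k (finRotate u i)) = Y i (k i)) :
    ∃ v : (pretzel k hk).End → ℝ, IsFoxColoring q o v ∧
      ∀ i, v (pretzelTop k hk i, 1) = X i 0 ∧ v (pretzelTop k hk i, 0) = Y i 0 := by
  let lev : Fin u → ℕ → ℤ := fun i j => if 0 < k i then j else -j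
  let v : PretzelCrossing k × Fin 4 → ℝ := fun h =>
    ![Y h.1.1 (lev h.1.1 h.1.2), X h.1.1 (lev h.1.1 h.1.2), X h.1.1 (lev h.1.1 (h.1.2 + 1)),
      Y h.1.1 (lev h.1.1 (h.1.2 + 1))] h.2
  have lev0 : ∀ i, lev i 0 = 0 := fun i => by simp [lev]
  have levk : ∀ i, lev i ((k i).natAbs - 1 + 1) = k i := by
    intro i
    have := hk i
    simp only [lev]
    split_ifs <;> omega
  have hm : ∀ h, v (pretzelMate k hk h) = v h := by
    refine pretzelMate_induction k hk (P := fun h h' => v h' = v h) (fun h h' e => e.symm) ?_ ?_ ?_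
      ?_
    · intro i
      change X (finRotate u i) (lev (finRotate u i) 0) = Y i (lev i 0)
      rw [lev0, lev0, htop]
    · intro i
      change X (finRotate u i) (lev (finRotate u i) ((k (finRotate u i)).natAbs - 1 + 1)) =
        Y i (lev i ((k i).natAbs - 1 + 1))
      rw [levk, levk, hbot]
    · intro i j h
      rfl
    · intro i j h
      rfl
  refine ⟨v, isFoxColoring_of_crossingRel hq hm ?_, fun i => ⟨?_, ?_⟩⟩
  · rintro ⟨i, j, hj⟩
    let f : PretzelCrossing k × Fin 4 → ℤ := fun h => o.dir h
    have hd := pretzel_dir_column (hk := hk) (f := f) (fun h => o.dir_mate h)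
      (fun x e => o.dir_add_two x e) i j hj
    have hc := hXY i
    have v0 : v (⟨i, ⟨j, hj⟩⟩, 0) = Y i (lev i j) := rfl
    have v1 : v (⟨i, ⟨j, hj⟩⟩, 1) = X i (lev i j) := rfl
    have v2 : v (⟨i, ⟨j, hj⟩⟩, 2) = X i (lev i (j + 1)) := rfl
    have v3 : v (⟨i, ⟨j, hj⟩⟩, 3) = Y i (lev i (j + 1)) := rfl
    unfold CrossingRel
    change if decide (0 < k i) = true then
      v (⟨i, ⟨j, hj⟩⟩, 2) = v (⟨i, ⟨j, hj⟩⟩, 0) ∧ v (⟨i, ⟨j, hj⟩⟩, 3) =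
        (q ^ 2) ^ (-f (⟨i, ⟨j, hj⟩⟩, 0)) * v (⟨i, ⟨j, hj⟩⟩, 1) +
        (1 - (q ^ 2) ^ (-f (⟨i, ⟨j, hj⟩⟩, 0))) * v (⟨i, ⟨j, hj⟩⟩, 0)
      else v (⟨i, ⟨j, hj⟩⟩, 3) = v (⟨i, ⟨j, hj⟩⟩, 1) ∧ v (⟨i, ⟨j, hj⟩⟩, 2) =
        (q ^ 2) ^ f (⟨i, ⟨j, hj⟩⟩, 1) * v (⟨i, ⟨j, hj⟩⟩, 0) +
        (1 - (q ^ 2) ^ f (⟨i, ⟨j, hj⟩⟩, 1)) * v (⟨i, ⟨j, hj⟩⟩, 1)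
    rw [v0, v1, v2, v3, hd.1, hd.2]
    by_cases hpos : 0 < k i
    · simp only [lev, hpos, decide_true, if_true]
      push_cast
      exact ⟨hc.left_pos j, hc.right_pos j⟩
    · simp only [lev, hpos, decide_false, if_false, Bool.false_eq_true]
      push_cast
      exact ⟨hc.right_neg j, hc.left_neg j⟩
  · change X i (lev i 0) = X i 0
    rw [lev0]
  · change Y i (lev i 0) = Y i 0
    rw [lev0]

/-- The linear system for the colourings of a pretzel diagram: the increment `d i` of the colour
across the top of column `i` sums up to zero, and the changes `g i` of the colour from the top to
the bottom of the gaps between the columns match those prescribed by the columns. -/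
theorem exists_isFoxColoring_pretzel_of_increments (o : (pretzel k hk).Orientation) {q : ℝ}
    (hq : q ≠ 0) {d g : Fin u → ℝ} (hd : ∑ i, d i = 0) (hd0 : ∃ i, d i ≠ 0)
    (hcol : ∀ i x, ∃ X Y, IsColumnColoring (q ^ 2) (o.dir (pretzelTop k hk i, 1))
      (o.dir (pretzelTop k hk i, 0)) X Y ∧ X 0 = x ∧ Y 0 = x + d i ∧
      X (k i) = x + g i ∧ Y (k i) = x + d i + g (finRotate u i)) :
    ∃ v : (pretzel k hk).End → ℝ, IsFoxColoring q o v ∧ ∃ h₁ h₂, v h₁ ≠ v h₂ := by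
  obtain ⟨x, hx, -⟩ := exists_sum_rotate_primitive d hd
  choose X Y hXY hX0 hY0 hXk hYk using fun i => hcol i (x i)
  obtain ⟨v, hv, hv'⟩ := exists_isFoxColoring_pretzel o hq hXY
    (fun i => by rw [hX0, hY0, hx]) (fun i => by rw [hXk, hYk, hx])
  obtain ⟨i, hi⟩ := hd0
  refine ⟨v, hv, (pretzelTop k hk i, 0), (pretzelTop k hk i, 1), ?_⟩
  rw [(hv' i).1, (hv' i).2, hX0, hY0]
  exact fun h => hi (by linarith)

/-- In a column with parallel strands, the changes of the colour on the two sides of the column are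
in the ratio `1 : -t ^ (-A)`. -/
theorem exists_isColumnColoring_parallel {t : ℝ} (ht : 0 < t) {A n : ℤ} {d g : ℝ} (x : ℝ)
    (h : (1 + t ^ (-A)) * g = (1 - (-t ^ (-A)) ^ n) * d) :
    ∃ X Y, IsColumnColoring t A A X Y ∧ X 0 = x ∧ Y 0 = x + d ∧
      X n = x + g ∧ Y n = x + d + -t ^ (-A) * g := by
  have hs : 1 + t ^ (-A) ≠ 0 := by positivity
  have hg : (1 - (-t ^ (-A)) ^ n) / (1 + t ^ (-A)) * d = g := by
    field_simp
    linarith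
  refine ⟨_, _, isColumnColoring_parallel ht A x d, by simp, by simp, by simp only [hg], ?_⟩
  simp only [hg]
  linarith

/-- In a column with antiparallel strands and an even number of half-twists, the changes of the
colour on the two sides of the column are the same. -/
theorem exists_isColumnColoring_antiparallel_even {t : ℝ} (ht : 0 < t) {A n : ℤ} (hn : Even n)
    {d g : ℝ} (x : ℝ) (h : g = n * (1 - t ^ A) / 2 * d) :
    ∃ X Y, IsColumnColoring t A (-A) X Y ∧ X 0 = x ∧ Y 0 = x + d ∧
      X n = x + g ∧ Y n = x + d + g := by
  refine ⟨_, _, isColumnColoring_antiparallel ht A x d, by simp, by simp, by simp [hn, h], ?_⟩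
  simp only [hn, if_true, ← h]
  ring

/-- In a column with antiparallel strands and an odd number of half-twists, the difference of the
changes of the colour on the two sides of the column is a fixed multiple of the increment. -/
theorem exists_isColumnColoring_antiparallel_odd {t : ℝ} (ht : 0 < t) {A n : ℤ} (hn : ¬ Even n)
    {d g : ℝ} (x : ℝ) (h : g = ((n + 1) - (n - 1) * t ^ A) / 2 * d) :
    ∃ X Y, IsColumnColoring t A (-A) X Y ∧ X 0 = x ∧ Y 0 = x + d ∧
      X n = x + g ∧ Y n = x + d + (g - (1 + t ^ A) * d) := by
  refine ⟨_, _, isColumnColoring_antiparallel ht A x d, by simp, by simp, by simp [hn, h], ?_⟩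
  simp only [hn, if_false, ← h]
  ring

/-- The increment `d` of the colour across a column with parallel strands, up to a term that depends
only on their direction: an odd function of the number of half-twists. -/
noncomputable def parallelIncrement (t : ℝ) (n : ℤ) : ℝ := (1 + t) * (1 / (1 - (-t) ^ n) - 1 / 2)

theorem neg_zpow_ne_one {t : ℝ} (ht : 1 < t) {n : ℤ} (hn : n ≠ 0) : (-t) ^ n ≠ 1 := by
  intro h
  have := congrArg abs h
  rw [abs_zpow, abs_neg, abs_one, abs_of_pos (zero_lt_one.trans ht)] at this
  exact hn ((zpow_eq_one_iff_right₀ (zero_lt_one.trans ht).le ht.ne').1 this)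

theorem parallelIncrement_neg {t : ℝ} (ht : 1 < t) {n : ℤ} (hn : n ≠ 0) :
    parallelIncrement t (-n) = -parallelIncrement t n := by
  have h1 := sub_ne_zero.2 (neg_zpow_ne_one ht hn).symm
  have h2 := sub_ne_zero.2 (neg_zpow_ne_one ht (neg_ne_zero.2 hn)).symm
  have h3 : (-t) ^ n ≠ 0 := zpow_ne_zero _ (neg_ne_zero.2 (zero_lt_one.trans ht).ne')
  unfold parallelIncrement
  rw [zpow_neg] at *
  generalize (-t) ^ n = w at *
  have h4 : w - 1 ≠ 0 := fun h => h1 (by linarith)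
  have h5 : 1 - w⁻¹ = (w - 1) / w := by field_simp
  rw [h5]
  field_simp
  ring

/-- The colouring in the case that the strands of all columns with an odd number of half-twists
are parallel.  The change of the colour along the gaps takes only two values, depending on the
direction of the bridge above the gap. -/
theorem exists_isFoxColoring_of_odd_parallel (o : (pretzel k hk).Orientation) {q : ℝ} (hq : 1 < q)
    (hu : 2 ≤ u) (hcomp : (pretzel k hk).numComponents = 2) (herase : Erasable (List.ofFn k))
    (hodd : ∀ i, ¬ Even (k i) →
      o.dir (pretzelTop k hk i, 0) = o.dir (pretzelTop k hk i, 1)) :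
    ∃ v : (pretzel k hk).End → ℝ, IsFoxColoring q o v ∧ ∃ h₁ h₂, v h₁ ≠ v h₂ := by
  classical
  have hq0 : q ≠ 0 := (zero_lt_one.trans hq).ne'
  have ht : 1 < q ^ 2 := one_lt_pow₀ hq two_ne_zero
  set t := q ^ 2 with htdef
  have ht0 : 0 < t := zero_lt_one.trans ht
  let A : Fin u → ℤ := fun i => o.dir (pretzelTop k hk i, 1)
  let B : Fin u → ℤ := fun i => o.dir (pretzelTop k hk i, 0)
  have hA : ∀ i, A i = 1 ∨ A i = -1 := fun i => o.dir_eq_or _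
  have hB : ∀ i, B i = 1 ∨ B i = -1 := fun i => o.dir_eq_or _
  have hrot : ∀ i, A (finRotate u i) = -B i := pretzel_dir_top (f := fun h => o.dir h)
    (fun h => o.dir_mate h)
  have hAB : ∀ i, B i ≠ A i → B i = -A i := by
    intro i h
    rcases hA i with h1 | h1 <;> rcases hB i with h2 | h2
    · exact absurd (h2.trans h1.symm) h
    · rw [h1, h2]
    · rw [h1, h2, neg_neg]
    · exact absurd (h2.trans h1.symm) h
  have hev : ∀ i, B i ≠ A i → Even (k i) := fun i h => by
    by_contra h'
    exact h (hodd i h')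
  -- The number of columns with antiparallel strands is even and at most two.
  have hanti : (∀ i, B i = A i) ∨ ∀ i, Even (k i) → B i ≠ A i := by
    let S := Finset.univ.filter fun i => B i ≠ A i
    let E := Finset.univ.filter fun i => Even (k i)
    have hSE : S ⊆ E := fun i hi => by
      rw [Finset.mem_filter] at hi ⊢
      exact ⟨hi.1, hev i hi.2⟩
    have hE : E.card ≤ 2 := by
      have := card_even_le_numComponents k hk (by rw [hcomp]; norm_num)
      rwa [hcomp] at this
    -- The direction changes sign along a bridge, so these products telescope around the diagram.
    have hprod : ∏ i, -(A i * B i) = 1 := by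
      have e1 : ∏ i, -(A i * B i) = (∏ i, A i) * ∏ i, A (finRotate u i) := by
        rw [← Finset.prod_mul_distrib]
        exact Finset.prod_congr rfl fun i _ => by rw [hrot]; ring
      rw [e1, Equiv.prod_comp, ← Finset.prod_mul_distrib]
      refine Finset.prod_eq_one fun i _ => ?_
      rcases hA i with h | h <;> rw [h] <;> norm_num
    have heven : Even u := by simpa using herase.length.2
    have hS : Even S.card := by
      have e2 : ∏ i, (A i * B i) = (-1) ^ S.card := by
        rw [← Finset.prod_const, Finset.prod_filter]
        refine Finset.prod_congr rfl fun i _ => ?_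
        rcases hA i with h1 | h1 <;> rcases hB i with h2 | h2 <;> simp [h1, h2]
      rw [Finset.prod_neg, Finset.card_univ, Fintype.card_fin, heven.neg_one_pow, one_mul, e2]
        at hprod
      exact (neg_one_pow_eq_one_iff_even (by norm_num)).1 hprod
    rcases Nat.eq_zero_or_pos S.card with h0 | h0
    · left
      intro i
      by_contra h
      have : i ∈ S := Finset.mem_filter.2 ⟨Finset.mem_univ i, h⟩
      rw [Finset.card_eq_zero] at h0
      rw [h0] at this
      exact Finset.notMem_empty i this
    · right
      intro i hi
      have : S = E := Finset.eq_of_subset_of_card_le hSE (by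
        obtain ⟨m, hm⟩ := hS
        omega)
      have hi' : i ∈ E := Finset.mem_filter.2 ⟨Finset.mem_univ i, hi⟩
      rw [← this] at hi'
      exact (Finset.mem_filter.1 hi').2
  -- The increments, up to a term proportional to `A i + B i`, which has total zero.
  let H : Fin u → ℝ := fun i =>
    if B i = A i then parallelIncrement t (k i) else 2 * t / (t - 1) / k i
  have hH : ∑ i, H i = 0 := by
    rcases hanti with h | h
    · rw [Finset.sum_congr rfl fun i _ => if_pos (h i)]
      exact herase.sum_odd fun i => parallelIncrement_neg ht (hk i)
    · have e : ∀ i, H i = (fun n : ℤ =>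
          if Even n then 2 * t / (t - 1) / n else parallelIncrement t n) (k i) := by
        intro i
        by_cases hi : Even (k i)
        · simp only [H, if_pos hi, if_neg (h i hi)]
        · simp only [H, if_neg hi]
          rw [if_pos (hodd i hi)]
      rw [Finset.sum_congr rfl fun i _ => e i]
      refine herase.sum_odd (F := fun n : ℤ =>
        if Even n then 2 * t / (t - 1) / n else parallelIncrement t n) fun i => ?_
      simp only [even_neg]
      split_ifs
      · push_cast
        rw [div_neg]
      · exact parallelIncrement_neg ht (hk i)
  have hsumAB : ∑ i, ((A i : ℝ) + B i) = 0 := by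
    have e : ∀ i, ((A i : ℝ) + B i) = A i - A (finRotate u i) := fun i => by
      rw [hrot]; push_cast; ring
    rw [Finset.sum_congr rfl fun i _ => e i, Finset.sum_sub_distrib,
      Equiv.sum_comp (finRotate u) fun i => (A i : ℝ), sub_self]
  let G : ℤ → ℝ := fun a => if a = 1 then -t else 1
  have hG : ∀ i, G (A i) ≠ 0 := fun i => by
    simp only [G]
    split_ifs
    · exact neg_ne_zero.2 ht0.ne'
    · exact one_ne_zero
  have hpar : ∀ i, B i = A i → (1 + t ^ (-A i)) * G (A i) =
      (1 - (-t ^ (-A i)) ^ k i) * (H i - (A i + B i) * ((1 + t) / 4)) := by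
    intro i h
    have h1 := sub_ne_zero.2 (neg_zpow_ne_one ht (hk i)).symm
    simp only [H, if_pos h, G, h, parallelIncrement]
    rcases hA i with h2 | h2
    · have e : -t ^ (-1 : ℤ) = (-t)⁻¹ := by rw [zpow_neg_one, inv_neg]
      have h3 : (-t) ^ k i ≠ 0 := zpow_ne_zero _ (neg_ne_zero.2 ht0.ne')
      rw [h2, if_pos rfl, e, inv_zpow, zpow_neg_one]
      generalize (-t) ^ k i = w at *
      push_cast
      field_simp
      ring
    · rw [h2, if_neg (by decide), neg_neg, zpow_one]
      generalize (-t) ^ k i = w at *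
      push_cast
      field_simp
      ring
  have hant : ∀ i, B i ≠ A i →
      G (A i) = k i * (1 - t ^ A i) / 2 * (H i - (A i + B i) * ((1 + t) / 4)) := by
    intro i h
    have hk0 : (k i : ℝ) ≠ 0 := Int.cast_ne_zero.2 (hk i)
    have ht1 : t - 1 ≠ 0 := sub_ne_zero.2 ht.ne'
    simp only [H, if_neg h, G, hAB i h]
    rcases hA i with h2 | h2
    · rw [h2, if_pos rfl, zpow_one]
      push_cast
      field_simp
      ring
    · rw [h2, if_neg (by decide), zpow_neg_one]
      push_cast
      field_simp
      ring
  refine exists_isFoxColoring_pretzel_of_increments o hq0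
    (d := fun i => H i - (A i + B i) * ((1 + t) / 4)) (g := fun i => G (A i)) ?_ ?_ ?_
  · rw [Finset.sum_sub_distrib, ← Finset.sum_mul, hH, hsumAB, zero_mul, sub_zero]
  · refine ⟨⟨0, by omega⟩, fun h => ?_⟩
    by_cases hi : B ⟨0, by omega⟩ = A ⟨0, by omega⟩
    · have := hpar _ hi
      rw [h, mul_zero] at this
      exact (mul_ne_zero (by positivity) (hG _)) this
    · have := hant _ hi
      rw [h, mul_zero] at this
      exact hG _ this
  · intro i x
    change ∃ X Y, IsColumnColoring t (A i) (B i) X Y ∧ _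
    by_cases hi : B i = A i
    · have hG' : G (A (finRotate u i)) = -t ^ (-A i) * G (A i) := by
        rw [hrot, hi]
        rcases hA i with h | h <;> simp only [G, h]
        · rw [if_neg (by decide), if_true, zpow_neg_one]
          field_simp
        · simp
      rw [hi, hG']
      have := hpar i hi
      rw [hi] at this
      exact exists_isColumnColoring_parallel ht0 x this
    · have := hant i hi
      rw [hrot]
      rw [hAB i hi] at this ⊢
      rw [neg_neg]
      exact exists_isColumnColoring_antiparallel_even ht0 (hev i hi) x this

/-- The colouring in the case that all columns have an odd number of half-twists and antiparallel
strands.  The changes of the colour along the gaps form a cyclic sequence with prescribed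
quotients. -/
theorem exists_isFoxColoring_of_antiparallel (o : (pretzel k hk).Orientation) {q : ℝ} (hq : 1 < q)
    (hirr : Irrational (q ^ 2)) (hu : 2 ≤ u) (herase : Erasable (List.ofFn k))
    (hodd : ∀ i, ¬ Even (k i))
    (hanti : ∀ i, o.dir (pretzelTop k hk i, 0) = -o.dir (pretzelTop k hk i, 1)) :
    ∃ v : (pretzel k hk).End → ℝ, IsFoxColoring q o v ∧ ∃ h₁ h₂, v h₁ ≠ v h₂ := by
  have hq0 : q ≠ 0 := (zero_lt_one.trans hq).ne'
  have ht0 : 0 < q ^ 2 := by positivity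
  let i₀ : Fin u := ⟨0, by omega⟩
  let A : Fin u → ℤ := fun i => o.dir (pretzelTop k hk i, 1)
  have hA : ∀ i, A i = A i₀ := finRotate_induction (p := fun i => A i = A i₀) rfl fun i hi => by
    rw [← hi]
    exact (pretzel_dir_top (f := fun h => o.dir h) (fun h => o.dir_mate h) i).trans
      ((congrArg Neg.neg (hanti i)).trans (neg_neg _))
  set a : ℝ := (q ^ 2) ^ A i₀ with hadef
  have ha0 : 0 < a := zpow_pos ht0 _
  have hairr : Irrational a := by
    rcases o.dir_eq_or (pretzelTop k hk i₀, 1) with h | h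
    · change A i₀ = 1 at h
      rwa [hadef, h, zpow_one]
    · change A i₀ = -1 at h
      rw [hadef, h, zpow_neg_one]
      exact hirr.inv
  let α : ℤ → ℝ := fun n => ((n + 1) - (n - 1) * a) / 2
  have hα : ∀ n, α n ≠ 0 := by
    intro n h
    have h1 : ((n : ℝ) - 1) * a = n + 1 := by simp only [α] at h; linarith
    by_cases hn : n = 1
    · subst hn
      norm_num at h1
    · have hn' : (n : ℝ) - 1 ≠ 0 := sub_ne_zero.2 (by exact_mod_cast hn)
      refine hairr ⟨((n + 1 : ℤ) : ℚ) / ((n - 1 : ℤ) : ℚ), ?_⟩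
      push_cast
      rw [← h1]
      field_simp
  have heven : Even u := by simpa using herase.length.2
  -- The changes of the colour on the two sides of a column are in the ratio `α n : -α (-n)`, and
  -- these ratios cancel around an erasable sequence.
  have hr : ∏ i, -α (-k i) / α (k i) = 1 := by
    rw [Finset.prod_div_distrib, Finset.prod_neg, Finset.card_univ, Fintype.card_fin,
      heven.neg_one_pow, one_mul, herase.prod_neg α,
      div_self (Finset.prod_ne_zero_iff.2 fun i _ => hα _)]
  obtain ⟨g, hg, hg0⟩ := exists_prod_rotate_primitive _ hr
  have hg' : ∀ i, g (finRotate u i) = g i - (1 + a) * (g i / α (k i)) := by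
    intro i
    rw [hg]
    have := hα (k i)
    field_simp
    simp only [α]
    push_cast
    ring
  refine exists_isFoxColoring_pretzel_of_increments o hq0 (d := fun i => g i / α (k i)) (g := g)
    ?_ ⟨i₀, ?_⟩ ?_
  · have e : ∀ i, g i / α (k i) = (g i - g (finRotate u i)) / (1 + a) := by
      intro i
      rw [hg']
      field_simp
      ring
    rw [Finset.sum_congr rfl fun i _ => e i, ← Finset.sum_div, Finset.sum_sub_distrib,
      Equiv.sum_comp (finRotate u) g, sub_self, zero_div]
  · rw [hg0 i₀ rfl]
    exact div_ne_zero one_ne_zero (hα _)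
  · intro i x
    rw [hanti]
    change ∃ X Y, IsColumnColoring (q ^ 2) (A i) (-A i) X Y ∧ _
    rw [hA, hg']
    refine exists_isColumnColoring_antiparallel_odd ht0 (hodd i) x ?_
    exact (mul_div_cancel₀ _ (hα _)).symm

end PretzelColorings

/-- Irrational parameters are used because the linear system for antiparallel columns degenerates at
certain rational ones. -/
theorem infinite_setOf_irrational_sq : {q : ℝ | 1 < q ∧ Irrational (q ^ 2)}.Infinite := by
  have hpos : ∀ n : ℕ, 0 ≤ √2 + n := fun n => by positivity
  refine Set.infinite_of_injective_forall_mem (f := fun n : ℕ => √(√2 + n)) ?_ ?_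
  · intro m n h
    have := (Real.sqrt_inj (hpos m) (hpos n)).1 h
    exact_mod_cast add_left_cancel this
  · intro n
    refine ⟨?_, ?_⟩
    · rw [Real.lt_sqrt zero_le_one, one_pow]
      have := Real.one_lt_sqrt_two
      have : (0 : ℝ) ≤ n := n.cast_nonneg
      linarith
    · rw [Real.sq_sqrt (hpos n)]
      exact irrational_sqrt_two.add_natCast n

theorem mainTheorem6 {u : ℕ} (k : Fin u → ℤ) (hk : ∀ i, k i ≠ 0)
    (hcomp : (pretzel k hk).numComponents = 2) (herase : Erasable (List.ofFn k))
    (o : (pretzel k hk).Orientation) (b : (pretzel k hk).End) (hb : o.out b = false) :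
    (pretzel k hk).conway o b = 0 := by
  have hu : 2 ≤ u := by simpa using herase.length.1
  refine conway_pretzel_eq_zero_of_coloring hu k hk o hb infinite_setOf_irrational_sq
    (fun q hq => hq.1) fun q hq => ?_
  by_cases hodd : ∀ i, ¬ Even (k i) →
      o.dir (pretzelTop k hk i, 0) = o.dir (pretzelTop k hk i, 1)
  · exact exists_isFoxColoring_of_odd_parallel o hq.1 hu hcomp herase hodd
  · simp only [not_forall] at hodd
    obtain ⟨i₀, hi₀, hne⟩ := hodd
    -- One column of odd length with antiparallel strands forces all columns to be of this kind.
    have hor : ∀ h, o.dir h = 1 ∨ o.dir h = -1 := o.dir_eq_or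
    have hneg : ∀ i, o.dir (pretzelTop k hk i, 1) * o.dir (pretzelTop k hk i, 0) = -1 →
        o.dir (pretzelTop k hk i, 0) = -o.dir (pretzelTop k hk i, 1) := by
      intro i h
      rcases hor (pretzelTop k hk i, 1) with h1 | h1 <;> rw [h1] at h ⊢ <;> linarith
    have hconst := finRotate_induction (i := i₀) (p := fun i => (if Even (k i) then 1 else
      o.dir (pretzelTop k hk i, 1) * o.dir (pretzelTop k hk i, 0)) = (-1 : ℤ)) (by
        rw [if_neg hi₀]
        rcases hor (pretzelTop k hk i₀, 1) with h1 | h1 <;>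
        rcases hor (pretzelTop k hk i₀, 0) with h0 | h0
        · exact absurd (h0.trans h1.symm) hne
        · rw [h1, h0, one_mul]
        · rw [h1, h0, mul_one]
        · exact absurd (h0.trans h1.symm) hne)
      fun i hi => (pretzel_dir_mul_rotate (f := fun h => o.dir h) (fun h => o.dir_mate h)
        (fun x e => o.dir_add_two x e) (fun h => o.dir_mul_self h) i).trans hi
    have hodd' : ∀ i, ¬ Even (k i) := fun i h => by
      have := hconst i
      rw [if_pos h] at this
      norm_num at this
    refine exists_isFoxColoring_of_antiparallel o hq.1 hq.2 hu herase hodd' fun i => hneg i ?_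
    have := hconst i
    rwa [if_neg (hodd' i)] at this
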